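/- Let $M$ be a smooth $n$-manifold (Hausdorff, second countable, without boundary) with a smooth Riemannian metric, let $\alpha=\sum_j \xi_j\,dx_j$ and $\omega=d\alpha$ be the canonical forms on $T^*M$, and write $|\xi|$ for the dual norm. Let $L$ be a smooth $n$-manifold. An immersion $i:L\to T^*M$ is \emph{Lagrangian} if $i^*\omega=0$ and \emph{exact} if moreover $i^*\alpha=df$ for some smooth $f:L\to\mathbf{R}$; such an $f$ is called a \emph{primitive}. An exact Lagrangian is \emph{lower exact} if every primitive for it is proper and bounded above. An exact Lagrangian $i:L\to T^*M$ is \emph{eventually conical} if $L_1:=\{p\in L: |\xi|(i(p))\le 1\}$ is compact, $i$ is an embedding on an open neighborhood of $\{p : |\xi|(i(p))\geq 1\}$, and $i$ maps $\{p: |\xi|(i(p))\geq 1\}$ onto the cone $\{(x,r\xi): (x,\xi)\in\Lambda_1,\ r\ge 1\}$ over some subset $\Lambda_1$ of the unit cosphere bundle $ST^*M$ (which is then a compact Legendrian submanifold); that is, $L$ is the conical completion of a compact exact filling $L_1\to\{|\xi|\le 1\}$ of $\Lambda_1$. Let $X_{|\xi|}$ be the Hamiltonian vector field of $|\xi|$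 on $T^*M$ minus the zero section, with the sign convention $\omega(X_H,\cdot)=-dH$, i.e. $X_H=\sum_j \frac{\partial H}{\partial \xi_j}\partial_{x_j}-\frac{\partial H}{\partial x_j}\partial_{\xi_j}$. Let $\beta:\mathbf{R}\to\mathbf{R}$ be smooth with $\beta(r)=0$ for $r<1$ and $\beta(r)=1/r$ for $r\ge r_0$, where $r_0>1$, and let $X(x,\xi)=\beta(|\xi|)X_{|\xi|}(x,\xi)$, extended by $0$ over the zero section. \textbf{Proposition.} Let $i:L\to T^*M$ be an eventually conical exact Lagrangian. \begin{enumerate} \item If $M$ is compact, then the vector field $X$ is complete, i.e. its flow $\varphi^t$ is defined on $T^*M$ for all $t\in\mathbf{R}$. \item Whenever the flow $\varphi^t$ of $X$ is defined on $T^*M$ for all times (whether or not $M$ is compact), for every $\epsilon_0>0$ the map $\varphi^{\epsilon_0}\circ i:L\to T^*M$ is a lower exact Lagrangian: it is an exact Lagrangian immersion, and every primitive $f_{\epsilon_0}$ for it is proper and bounded above; moreover $f_{\epsilon_0}$ tends to $-\infty$ at infinity, i.e. along the filter of complements of compact subsets of $L$. \end{enumerate} -/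

import Mathlib

open Bundle Set Filter Topology Manifold
open scoped Manifold ContDiff

noncomputable section

/-- The cotangent bundle `T*M` of an `n`-manifold `M`: pairs `p = ⟨x, ξ⟩` with `x : M` and
`ξ : T_x M →L[ℝ] ℝ`, as the dual (hom) bundle of the tangent bundle. -/
abbrev Cotangent (n : ℕ) (M : Type*) [TopologicalSpace M]
    [ChartedSpace (EuclideanSpace ℝ (Fin n)) M] : Type _ :=
  TotalSpace (EuclideanSpace ℝ (Fin n) →L[ℝ] ℝ)
    (fun x : M ↦ TangentSpace (𝓡 n) x →L[ℝ] Bundle.Trivial M ℝ x)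

/-- The model with corners of `T*M`, with model vector space `ℝⁿ × (ℝⁿ)*`. -/
abbrev cotangentModel (n : ℕ) :=
  (𝓡 n).prod 𝓘(ℝ, EuclideanSpace ℝ (Fin n) →L[ℝ] ℝ)

section Symplectic

variable {n : ℕ} {M : Type*} [TopologicalSpace M] [ChartedSpace (EuclideanSpace ℝ (Fin n)) M]
  [IsManifold (𝓡 n) ∞ M]

/-- The covector `ξ` of a point `(x, ξ)` of `T*M`. -/
def covector (p : Cotangent n M) : TangentSpace (𝓡 n) p.proj →L[ℝ] ℝ := p.snd

/-- The canonical one-form `α = ∑ ξⱼ dxⱼ` on `T*M`: `α_{(x,ξ)} = ξ ∘ dπ`. -/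
def canonicalOneForm (p : Cotangent n M) : TangentSpace (cotangentModel n) p →L[ℝ] ℝ :=
  (covector p).comp
    (mfderiv (cotangentModel n) (𝓡 n) (TotalSpace.proj : Cotangent n M → M) p)

/-- The canonical one-form read in the chart of `T*M` at `p₀`, that is, its pull-back
under the inverse of this chart. -/
def canonicalOneFormInChart (p₀ : Cotangent n M)
    (z : EuclideanSpace ℝ (Fin n) × (EuclideanSpace ℝ (Fin n) →L[ℝ] ℝ)) :
    EuclideanSpace ℝ (Fin n) × (EuclideanSpace ℝ (Fin n) →L[ℝ] ℝ) →L[ℝ] ℝ :=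
  (canonicalOneForm ((extChartAt (cotangentModel n) p₀).symm z)).comp
    (mfderiv 𝓘(ℝ, EuclideanSpace ℝ (Fin n) × (EuclideanSpace ℝ (Fin n) →L[ℝ] ℝ))
      (cotangentModel n) (extChartAt (cotangentModel n) p₀).symm z)

lemma cotangent_extChartAt_symm_proj (p₀ : Cotangent n M)
    (z : EuclideanSpace ℝ (Fin n) × (EuclideanSpace ℝ (Fin n) →L[ℝ] ℝ))
    (hz : z ∈ (extChartAt (cotangentModel n) p₀).target) :
    ((extChartAt (cotangentModel n) p₀).symm z).proj = (extChartAt (𝓡 n) p₀.proj).symm z.1 := by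
  have hz' := hz
  rw [FiberBundle.extChartAt_target] at hz'
  rw [FiberBundle.extChartAt]
  exact (trivializationAt (EuclideanSpace ℝ (Fin n) →L[ℝ] ℝ) (fun x : M ↦ TangentSpace (𝓡 n) x →L[ℝ] Bundle.Trivial M ℝ x) p₀.proj).proj_symm_apply' hz'.1.2

lemma covector_extChartAt_symm (p₀ : Cotangent n M)
    (z : EuclideanSpace ℝ (Fin n) × (EuclideanSpace ℝ (Fin n) →L[ℝ] ℝ))
    (hz : z ∈ (extChartAt (cotangentModel n) p₀).target) (q : Cotangent n M) 
    (hq : q = (extChartAt (cotangentModel n) p₀).symm z)  :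
    covector q = z.2.comp (mfderiv (𝓡 n) 𝓘(ℝ, EuclideanSpace ℝ (Fin n)) (extChartAt (𝓡 n) p₀.proj) q.proj) := by
  have hp := cotangent_extChartAt_symm_proj p₀ z hz
  have hz' := hz
  rw [FiberBundle.extChartAt_target] at hz'
  have hm : q ∈ (extChartAt (cotangentModel n) p₀).source := hq ▸ (extChartAt (cotangentModel n) p₀).map_target hz
  have hqs : q.proj ∈ (chartAt (EuclideanSpace ℝ (Fin n)) p₀.proj).source := by
    rw [hq, hp, ← extChartAt_source (𝓡 n)]
    exact (extChartAt (𝓡 n) p₀.proj).map_target hz'.1.1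
  have hzq : z = extChartAt (cotangentModel n) p₀ q := by
    rw [hq, (extChartAt (cotangentModel n) p₀).right_inv hz]
  rw [← TangentBundle.continuousLinearMapAt_trivializationAt hqs]
  have h2 : z.2 = (ContinuousLinearMap.inCoordinates (EuclideanSpace ℝ (Fin n)) (TangentSpace (𝓡 n)) ℝ (Bundle.Trivial M ℝ) p₀.proj q.proj p₀.proj q.proj q.snd) := by
    rw [hzq, FiberBundle.extChartAt]
    rfl
  rw [h2]
  ext v
  simp only [ContinuousLinearMap.inCoordinates, ContinuousLinearMap.comp_apply]
  have := (trivializationAt (EuclideanSpace ℝ (Fin n)) (TangentSpace (𝓡 n)) p₀.proj).symmL_continuousLinearMapAt (R := ℝ) (b := q.proj) hqs v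
  erw [this]
  simp
  rfl

lemma canonicalOneFormInChart_eq (p₀ : Cotangent n M)
    (z : EuclideanSpace ℝ (Fin n) × (EuclideanSpace ℝ (Fin n) →L[ℝ] ℝ))
    (hz : z ∈ (extChartAt (cotangentModel n) p₀).target) :
    canonicalOneFormInChart p₀ z = z.2.comp (ContinuousLinearMap.fst ℝ _ _) := by
  have hz' := hz
  rw [FiberBundle.extChartAt_target] at hz'
  have hz1 : z.1 ∈ (extChartAt (𝓡 n) p₀.proj).target := hz'.1.1
  have hp := cotangent_extChartAt_symm_proj p₀ z hz
  have hnhds : (extChartAt (cotangentModel n) p₀).target ∈ 𝓝 z := by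
    refine extChartAt_target_mem_nhds' ?_ 
    exact hz
  have hd : MDifferentiableAt 𝓘(ℝ, EuclideanSpace ℝ (Fin n) × (EuclideanSpace ℝ (Fin n) →L[ℝ] ℝ))
      (cotangentModel n) (extChartAt (cotangentModel n) p₀).symm z := by
    have := mdifferentiableWithinAt_extChartAt_symm (I := cotangentModel n) hz
    rw [ModelWithCorners.range_eq_univ, mdifferentiableWithinAt_univ] at this
    exact this
  have hd1 : MDifferentiableAt 𝓘(ℝ, EuclideanSpace ℝ (Fin n)) (𝓡 n)
      (extChartAt (𝓡 n) p₀.proj).symm z.1 := by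
    have := mdifferentiableWithinAt_extChartAt_symm (I := 𝓡 n) hz1
    rw [ModelWithCorners.range_eq_univ, mdifferentiableWithinAt_univ] at this
    exact this
  have hproj : MDifferentiableAt (cotangentModel n) (𝓡 n) (TotalSpace.proj : Cotangent n M → M)
      ((extChartAt (cotangentModel n) p₀).symm z) :=
    (contMDiffAt_proj (n := ∞) _).mdifferentiableAt (by simp)
  have hcomp := mfderiv_comp z hproj hd
  have heq : (TotalSpace.proj : Cotangent n M → M) ∘ (extChartAt (cotangentModel n) p₀).symm
      =ᶠ[𝓝 z] (extChartAt (𝓡 n) p₀.proj).symm ∘ Prod.fst := by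
    filter_upwards [hnhds] with y hy using cotangent_extChartAt_symm_proj p₀ y hy
  have hfst : MDifferentiableAt 𝓘(ℝ, EuclideanSpace ℝ (Fin n) × (EuclideanSpace ℝ (Fin n) →L[ℝ] ℝ)) 𝓘(ℝ, EuclideanSpace ℝ (Fin n)) (Prod.fst : EuclideanSpace ℝ (Fin n) × (EuclideanSpace ℝ (Fin n) →L[ℝ] ℝ) → _) z :=
    differentiableAt_fst.mdifferentiableAt
  have hcomp2 := mfderiv_comp z hd1 hfst
  rw [heq.mfderiv_eq] at hcomp
  have hc := mfderiv_extChartAt_comp_mfderivWithin_extChartAt_symm (I := 𝓡 n) hz1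
  rw [ModelWithCorners.range_eq_univ, mfderivWithin_univ] at hc
  have hcov := covector_extChartAt_symm p₀ z hz _ rfl
  unfold canonicalOneFormInChart canonicalOneForm
  rw [hcov]
  refine ContinuousLinearMap.ext fun u => ?_
  have e1 := congrArg (fun l => l u) (hcomp.symm.trans hcomp2)
  have e2 : mfderiv 𝓘(ℝ, EuclideanSpace ℝ (Fin n) × (EuclideanSpace ℝ (Fin n) →L[ℝ] ℝ)) 𝓘(ℝ, EuclideanSpace ℝ (Fin n)) (Prod.fst : EuclideanSpace ℝ (Fin n) × (EuclideanSpace ℝ (Fin n) →L[ℝ] ℝ) → _) z u = u.1 := by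
    rw [mfderiv_eq_fderiv, fderiv_fst]
    rfl
  have e3 := congrArg (fun l => l u.1) hc
  have e4 := e1.trans (congrArg (mfderiv 𝓘(ℝ, EuclideanSpace ℝ (Fin n)) (𝓡 n)
    (extChartAt (𝓡 n) p₀.proj).symm z.1) e2)
  have e5 : mfderiv (𝓡 n) 𝓘(ℝ, EuclideanSpace ℝ (Fin n)) (extChartAt (𝓡 n) p₀.proj)
      ((extChartAt (cotangentModel n) p₀).symm z).proj
      (mfderiv 𝓘(ℝ, EuclideanSpace ℝ (Fin n)) (𝓡 n) (extChartAt (𝓡 n) p₀.proj).symm z.1 u.1)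
      = u.1 := by
    rw [hp]
    exact e3
  exact congrArg z.2 ((congrArg (mfderiv (𝓡 n) 𝓘(ℝ, EuclideanSpace ℝ (Fin n))
    (extChartAt (𝓡 n) p₀.proj) ((extChartAt (cotangentModel n) p₀).symm z).proj) e4).trans e5)

/-- The canonical symplectic form `ω = dα` on `T*M`: the exterior derivative
`(D_v α)(w) - (D_w α)(v)` of `α`, computed in the chart at `p`, which is the chart that identifies
`T_p(T*M)` with the model space `ℝⁿ × (ℝⁿ)*`. -/
def canonicalTwoForm (p : Cotangent n M) (v w : TangentSpace (cotangentModel n) p) : ℝ :=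
  fderiv ℝ (canonicalOneFormInChart p) (extChartAt (cotangentModel n) p p) v w
    - fderiv ℝ (canonicalOneFormInChart p) (extChartAt (cotangentModel n) p p) w v

/-- In the coordinates `(x, ξ)`, `ω = ∑ dξⱼ ∧ dxⱼ`. -/
lemma canonicalTwoForm_apply (p : Cotangent n M) (v w : TangentSpace (cotangentModel n) p) :
    canonicalTwoForm p v w =
      (show EuclideanSpace ℝ (Fin n) →L[ℝ] ℝ from v.2) w.1 -
        (show EuclideanSpace ℝ (Fin n) →L[ℝ] ℝ from w.2) v.1 := by
  have h : canonicalOneFormInChart p =ᶠ[𝓝 (extChartAt (cotangentModel n) p p)]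
      fun z => z.2.comp (ContinuousLinearMap.fst ℝ _ _) := by
    filter_upwards [extChartAt_target_mem_nhds (I := cotangentModel n) p] with z hz
    exact canonicalOneFormInChart_eq p z hz
  have h' := (HasFDerivAt.clm_comp (hasFDerivAt_snd (𝕜 := ℝ) (p := extChartAt (cotangentModel n) p p))
    (hasFDerivAt_const (ContinuousLinearMap.fst ℝ (EuclideanSpace ℝ (Fin n))
      (EuclideanSpace ℝ (Fin n) →L[ℝ] ℝ)) _)).congr_of_eventuallyEq h
  unfold canonicalTwoForm
  rw [h'.fderiv]
  simp
  rfl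

/-- `ω` is nondegenerate. -/
lemma existsUnique_canonicalTwoForm (p : Cotangent n M)
    (l : TangentSpace (cotangentModel n) p →L[ℝ] ℝ) :
    ∃! v : TangentSpace (cotangentModel n) p, ∀ w, canonicalTwoForm p v w = - l w := by
  let T := InnerProductSpace.toDual ℝ (EuclideanSpace ℝ (Fin n))
  let l' : EuclideanSpace ℝ (Fin n) × (EuclideanSpace ℝ (Fin n) →L[ℝ] ℝ) →L[ℝ] ℝ := l
  let v₂ : EuclideanSpace ℝ (Fin n) →L[ℝ] ℝ := -(l'.comp (ContinuousLinearMap.inl ℝ _ _))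
  let m : EuclideanSpace ℝ (Fin n) →L[ℝ] ℝ :=
    (l'.comp (ContinuousLinearMap.inr ℝ _ _)).comp T.toContinuousLinearEquiv.toContinuousLinearMap
  let v₁ : EuclideanSpace ℝ (Fin n) := T.symm m
  have key : ∀ η : EuclideanSpace ℝ (Fin n) →L[ℝ] ℝ, η v₁ = l' (0, η) := by
    intro η
    have h1 : η = T (T.symm η) := (T.apply_symm_apply η).symm
    have h2 : (T v₁) (T.symm η) = m (T.symm η) := by rw [T.apply_symm_apply m]
    have h3 : m (T.symm η) = l' (0, T (T.symm η)) := rfl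
    rw [← h1] at h3
    rw [← h3, ← h2]
    conv_lhs => rw [h1]
    rw [InnerProductSpace.toDual_apply_apply, InnerProductSpace.toDual_apply_apply,
      real_inner_comm]
  refine ⟨((v₁, v₂) : EuclideanSpace ℝ (Fin n) × (EuclideanSpace ℝ (Fin n) →L[ℝ] ℝ)), ?_, ?_⟩
  · intro w
    refine (canonicalTwoForm_apply p _ w).trans ?_
    change -(l' (w.1, 0)) - (show EuclideanSpace ℝ (Fin n) →L[ℝ] ℝ from w.2) v₁ = - l' w
    have h4 : l' w = l' (w.1, 0) + l' (0, w.2) := by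
      rw [← map_add, Prod.mk_add_mk, add_zero, zero_add]
      rfl
    rw [h4]
    have := key w.2
    linarith
  · intro v hv
    have h5 : ∀ w : EuclideanSpace ℝ (Fin n) × (EuclideanSpace ℝ (Fin n) →L[ℝ] ℝ),
        (show EuclideanSpace ℝ (Fin n) →L[ℝ] ℝ from v.2) w.1 - w.2 v.1 = - l' w := fun w ↦ by
      exact (canonicalTwoForm_apply p v w).symm.trans (hv w)
    refine Prod.ext ?_ ?_
    · have h6 : T v.1 = T v₁ := by
        refine ContinuousLinearMap.ext fun u ↦ ?_
        have h7 := h5 (0, T u)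
        have h8 := key (T u)
        simp only [map_zero, zero_sub, neg_inj] at h7
        rw [← h8] at h7
        rw [InnerProductSpace.toDual_apply_apply, InnerProductSpace.toDual_apply_apply] at h7 ⊢
        rw [real_inner_comm, h7, real_inner_comm]
      exact T.injective h6
    · refine ContinuousLinearMap.ext fun u ↦ ?_
      have h7 := h5 (u, 0)
      simp only [zero_apply, sub_zero] at h7
      exact h7

/-- The Hamiltonian vector field `X_H` on `T*M`: `ω(X_H, ·) = -dH`, that is,
`X_H = ∑ (∂H/∂ξⱼ) ∂/∂xⱼ - (∂H/∂xⱼ) ∂/∂ξⱼ`. -/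
def hamiltonianVectorField (H : Cotangent n M → ℝ) (p : Cotangent n M) :
    TangentSpace (cotangentModel n) p :=
  (existsUnique_canonicalTwoForm p (mfderiv (cotangentModel n) 𝓘(ℝ, ℝ) H p)).choose

lemma canonicalTwoForm_hamiltonianVectorField (H : Cotangent n M → ℝ) (p : Cotangent n M)
    (w : TangentSpace (cotangentModel n) p) :
    canonicalTwoForm p (hamiltonianVectorField H p) w
      = - mfderiv (cotangentModel n) 𝓘(ℝ, ℝ) H p w :=
  (existsUnique_canonicalTwoForm p (mfderiv (cotangentModel n) 𝓘(ℝ, ℝ) H p)).choose_spec.1 w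

/-- `φ t` is the time-`t` flow of the vector field `X` on `T*M`. -/
def IsFlowOf (X : (p : Cotangent n M) → TangentSpace (cotangentModel n) p)
    (φ : ℝ → Cotangent n M → Cotangent n M) : Prop :=
  ∀ p, φ 0 p = p ∧ IsMIntegralCurve (I := cotangentModel n) (fun t ↦ φ t p) X

end Symplectic

section Lagrangian

variable {n : ℕ} {M : Type*} [TopologicalSpace M] [ChartedSpace (EuclideanSpace ℝ (Fin n)) M]
  [IsManifold (𝓡 n) ∞ M]
  {L : Type*} [TopologicalSpace L] [ChartedSpace (EuclideanSpace ℝ (Fin n)) L]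

/-- A smooth immersion `i : L → T*M` with `dim L = dim M` is Lagrangian if `i^* ω = 0`. -/
structure IsLagrangianImmersion (i : L → Cotangent n M) : Prop where
  contMDiff : ContMDiff (𝓡 n) (cotangentModel n) ∞ i
  injective_mfderiv : ∀ p, Function.Injective (mfderiv (𝓡 n) (cotangentModel n) i p)
  pullback_eq_zero : ∀ p (v w : TangentSpace (𝓡 n) p),
    canonicalTwoForm (i p) (mfderiv (𝓡 n) (cotangentModel n) i p v)
      (mfderiv (𝓡 n) (cotangentModel n) i p w) = 0

/-- A primitive for `i : L → T*M` is a smooth function `f` on `L` with `df = i^* α`. -/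
structure IsPrimitive (i : L → Cotangent n M) (f : L → ℝ) : Prop where
  contMDiff : ContMDiff (𝓡 n) 𝓘(ℝ, ℝ) ∞ f
  mfderiv_eq : ∀ p (v : TangentSpace (𝓡 n) p),
    mfderiv (𝓡 n) 𝓘(ℝ, ℝ) f p v
      = canonicalOneForm (i p) (mfderiv (𝓡 n) (cotangentModel n) i p v)

/-- An exact Lagrangian (immersion): `i^* α` is an exact one-form. -/
structure IsExactLagrangian (i : L → Cotangent n M) : Prop where
  isLagrangianImmersion : IsLagrangianImmersion i
  exists_primitive : ∃ f, IsPrimitive i f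

/-- An exact Lagrangian is lower exact if any primitive for it is proper and bounded above. -/
structure IsLowerExact (i : L → Cotangent n M) : Prop where
  isExactLagrangian : IsExactLagrangian i
  isProperMap : ∀ f, IsPrimitive i f → IsProperMap f
  bddAbove : ∀ f, IsPrimitive i f → BddAbove (range f)

/-- Fibrewise scaling `(x, ξ) ↦ (x, r ξ)` of `T*M`. -/
def fiberScale (r : ℝ) (p : Cotangent n M) : Cotangent n M := ⟨p.proj, r • p.snd⟩

variable [RiemannianBundle (fun x : M ↦ TangentSpace (𝓡 n) x)]

/-- The length `|ξ|` of the covector of `p = (x, ξ)`: the dual norm of the Riemannian metric. -/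
def conorm (p : Cotangent n M) : ℝ := ‖covector p‖

/-- The exact Lagrangian `i : L → T*M` is eventually conical: it is the union of a compact exact
filling `{|ξ| ≤ 1}` and the cone `{(x, rξ) | (x, ξ) ∈ Λ, r ≥ 1}` over a subset `Λ` of the unit
cosphere bundle, and it is embedded near that cone. (Then `Λ` is automatically compact, smooth and
Legendrian.) -/
structure IsEventuallyConical (i : L → Cotangent n M) : Prop where
  isExactLagrangian : IsExactLagrangian i
  isCompact_core : IsCompact {p | conorm (i p) ≤ 1}
  exists_cone : ∃ Λ : Set (Cotangent n M), (∀ q ∈ Λ, conorm q = 1) ∧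
    i '' {p | 1 ≤ conorm (i p)} = {q | ∃ q₀ ∈ Λ, ∃ r : ℝ, 1 ≤ r ∧ q = fiberScale r q₀}
  exists_embedded : ∃ U : Set L, IsOpen U ∧ {p | 1 ≤ conorm (i p)} ⊆ U ∧
    IsEmbedding (U.domRestrict i)

/-- The vector field `X(x, ξ) = β(|ξ|) X_{|ξ|}` of the Reeb perturbation. -/
def reebPerturbation (β : ℝ → ℝ) (p : Cotangent n M) : TangentSpace (cotangentModel n) p :=
  β (conorm p) • hamiltonianVectorField conorm p

end Lagrangian

end

section SmoothFlow

universe u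

/-- Pointwise application of a continuous bilinear map to a pair of continuous families of
vectors, as a continuous bilinear map. -/
noncomputable def pointwiseBilinL (K : Type*) [TopologicalSpace K] [CompactSpace K]
    {X E G : Type*} [NormedAddCommGroup X] [NormedSpace ℝ X] [NormedAddCommGroup E]
    [NormedSpace ℝ E] [NormedAddCommGroup G] [NormedSpace ℝ G] (B : X →L[ℝ] E →L[ℝ] G) :
    C(K, X) →L[ℝ] C(K, E) →L[ℝ] C(K, G) :=
  LinearMap.mkContinuous₂
    (LinearMap.mk₂ ℝ (fun (A : C(K, X)) (γ : C(K, E)) ↦ (⟨fun t ↦ B (A t) (γ t),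
        (B.continuous.comp A.continuous).clm_apply γ.continuous⟩ : C(K, G)))
      (fun _ _ _ ↦ by ext; simp) (fun _ _ _ ↦ by ext; simp)
      (fun _ _ _ ↦ by ext; simp) (fun _ _ _ ↦ by ext; simp)) ‖B‖ (fun A γ ↦ by
        rw [ContinuousMap.norm_le _ (by positivity)]
        intro t
        refine (B.le_opNorm₂ _ _).trans ?_
        have h1 := A.norm_coe_le_norm t
        have h2 := γ.norm_coe_le_norm t
        gcongr)

@[simp] lemma pointwiseBilinL_apply {K : Type*} [TopologicalSpace K] [CompactSpace K]
    {X E G : Type*} [NormedAddCommGroup X] [NormedSpace ℝ X] [NormedAddCommGroup E]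
    [NormedSpace ℝ E] [NormedAddCommGroup G] [NormedSpace ℝ G] (B : X →L[ℝ] E →L[ℝ] G)
    (A : C(K, X)) (γ : C(K, E)) (t : K) :
    pointwiseBilinL K B A γ t = B (A t) (γ t) := rfl

lemma hasFDerivAt_continuousMap_comp {K : Type*} [TopologicalSpace K] [CompactSpace K]
    {E G : Type*} [NormedAddCommGroup E] [NormedSpace ℝ E] [NormedAddCommGroup G]
    [NormedSpace ℝ G] (F : C(E, G)) (F' : C(E, E →L[ℝ] G)) (hF : ∀ x, HasFDerivAt F (F' x) x)
    (γ : C(K, E)) :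
    HasFDerivAt (fun γ : C(K, E) ↦ F.comp γ) (pointwiseBilinL K (.id ℝ (E →L[ℝ] G)) (F'.comp γ)) γ := by
  rw [hasFDerivAt_iff_isLittleO_nhds_zero, Asymptotics.isLittleO_iff]
  intro c hc
  have hK : IsCompact (range γ) := isCompact_range γ.continuous
  have hu := hK.uniformContinuousAt_of_continuousAt F' (fun a _ ↦ F'.continuous.continuousAt)
    (Metric.dist_mem_uniformity hc)
  obtain ⟨δ, hδ, hδ'⟩ := Metric.mem_uniformity_dist.1 hu
  filter_upwards [Metric.ball_mem_nhds (0 : C(K, E)) hδ] with h hh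
  rw [ContinuousMap.norm_le _ (by positivity)]
  intro t
  have hht : ‖h t‖ < δ := (h.norm_coe_le_norm t).trans_lt (by simpa using hh)
  have key := (convex_ball (γ t) δ).norm_image_sub_le_of_norm_fderiv_le' (𝕜 := ℝ) (f := F)
    (C := c) (φ := F' (γ t)) (x := γ t) (y := γ t + h t)
    (fun x _ ↦ (hF x).differentiableAt) (fun x hx ↦ by
      rw [(hF x).fderiv, ← dist_eq_norm, dist_comm]
      exact (hδ' (a := γ t) (b := x) (by rw [dist_comm]; exact hx) ⟨t, rfl⟩).le)
    (Metric.mem_ball_self hδ) (by simpa using hht)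
  rw [add_sub_cancel_left] at key
  refine le_trans (le_of_eq ?_) (key.trans (mul_le_mul_of_nonneg_left (h.norm_coe_le_norm t) hc.le))
  simp

lemma contDiff_continuousMap_comp {K : Type*} [TopologicalSpace K] [CompactSpace K]
    {E : Type u} [NormedAddCommGroup E] [NormedSpace ℝ E] (m : ℕ) :
    ∀ {G : Type u} [NormedAddCommGroup G] [NormedSpace ℝ G] (F : C(E, G)),
      ContDiff ℝ m F → ContDiff ℝ m (fun γ : C(K, E) ↦ F.comp γ) := by
  induction m with
  | zero =>
    intro G _ _ F _
    rw [Nat.cast_zero, contDiff_zero]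
    exact F.continuous_postcomp
  | succ m ih =>
    intro G _ _ F hF
    rw [Nat.cast_succ] at hF ⊢
    obtain ⟨F', hF', h⟩ := contDiff_succ_iff_hasFDerivAt.1 hF
    exact contDiff_succ_iff_hasFDerivAt.2 ⟨_, (pointwiseBilinL K (.id ℝ (E →L[ℝ] G))).contDiff.comp
      (ih (⟨F', hF'.continuous⟩ : C(E, E →L[ℝ] G)) hF'),
      hasFDerivAt_continuousMap_comp F ⟨F', hF'.continuous⟩ h⟩

/-- The primitive vanishing at `0` of a continuous function on `[0, 1]`, as a continuous linear
map. -/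
noncomputable def unitIntegralL (E : Type*) [NormedAddCommGroup E] [NormedSpace ℝ E]
    [CompleteSpace E] : C(Icc (0 : ℝ) 1, E) →L[ℝ] C(Icc (0 : ℝ) 1, E) :=
  have hc : ∀ γ : C(Icc (0 : ℝ) 1, E), Continuous fun σ : ℝ ↦ γ (projIcc 0 1 zero_le_one σ) :=
    fun γ ↦ γ.continuous.comp continuous_projIcc
  LinearMap.mkContinuous
    { toFun := fun γ ↦ ⟨fun s ↦ ∫ σ in (0 : ℝ)..s, γ (projIcc 0 1 zero_le_one σ),
        (intervalIntegral.continuous_primitive (fun _ _ ↦ (hc γ).intervalIntegrable _ _) 0).comp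
          continuous_subtype_val⟩
      map_add' := fun γ₁ γ₂ ↦ by
        ext s
        exact intervalIntegral.integral_add ((hc γ₁).intervalIntegrable _ _)
          ((hc γ₂).intervalIntegrable _ _)
      map_smul' := fun c γ ↦ by
        ext s
        exact intervalIntegral.integral_smul c _ } 1 (fun γ ↦ by
      rw [ContinuousMap.norm_le _ (by positivity), one_mul]
      intro s
      refine (intervalIntegral.norm_integral_le_of_norm_le_const (C := ‖γ‖)
        (fun σ _ ↦ γ.norm_coe_le_norm _)).trans ?_
      rw [sub_zero, abs_of_nonneg s.2.1]
      exact mul_le_of_le_one_right (norm_nonneg _) s.2.2)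

lemma unitIntegralL_apply {E : Type*} [NormedAddCommGroup E] [NormedSpace ℝ E]
    [CompleteSpace E] (γ : C(Icc (0 : ℝ) 1, E)) (s : Icc (0 : ℝ) 1) :
    unitIntegralL E γ s = ∫ σ in (0 : ℝ)..s, γ (projIcc 0 1 zero_le_one σ) := rfl

/-- The local flow of a `C^m` vector field on a Banach space is `C^m` in time and space. -/
theorem exists_contDiffAt_localFlow {E : Type u} [NormedAddCommGroup E] [NormedSpace ℝ E]
    [CompleteSpace E] {m : ℕ} (hm : m ≠ 0) {F : E → E} (hF : ContDiff ℝ m F) (z₀ : E) :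
    ∃ Ψ : E × ℝ → E, ContDiffAt ℝ m Ψ (z₀, 0) ∧ ∃ δ > 0, ∀ z ∈ Metric.ball z₀ δ,
      Ψ (z, 0) = z ∧ ∀ t ∈ Ioo (-δ) δ, HasDerivAt (fun t ↦ Ψ (z, t)) (F (Ψ (z, t))) t := by
  have hF1 : ContDiffAt ℝ 1 F z₀ := (hF.of_le (by exact_mod_cast Nat.one_le_iff_ne_zero.2 hm)).contDiffAt
  obtain ⟨ε, hε, a, r, L, K, hr, hpl⟩ := IsPicardLindelof.of_contDiffAt_one hF1
  obtain ⟨α, hα, hαc⟩ := (hpl 0).exists_forall_mem_closedBall_eq_hasDerivWithinAt_continuousOn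
  simp only [zero_sub, zero_add] at hα hαc
  have hr' : (0 : ℝ) < r := hr
  have hα' : ∀ z ∈ Metric.closedBall z₀ (r : ℝ), ∀ t ∈ Ioo (-ε) ε,
      HasDerivAt (fun t ↦ α (z, t)) (F (α (z, t))) t := fun z hz t ht ↦
    ((hα z hz).2 t (Ioo_subset_Icc_self ht)).hasDerivAt (Icc_mem_nhds ht.1 ht.2)
  have hαz₀ : α (z₀, 0) = z₀ := (hα z₀ (Metric.mem_closedBall_self r.2)).1
  have hcα : ContinuousAt α (z₀, 0) := hαc.continuousAt
    (prod_mem_nhds (Metric.closedBall_mem_nhds _ hr') (Icc_mem_nhds (by linarith) hε))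
  refine ⟨α, ?_, min r ε, lt_min hr' hε, fun z hz ↦ ?_⟩
  swap
  · have hz' : z ∈ Metric.closedBall z₀ (r : ℝ) :=
      Metric.ball_subset_closedBall (Metric.ball_subset_ball (min_le_left _ _) hz)
    exact ⟨(hα z hz').1, fun t ht ↦ hα' z hz' t
      ⟨by linarith [ht.1, min_le_right (r : ℝ) ε], by linarith [ht.2, min_le_right (r : ℝ) ε]⟩⟩
  let F₀ : C(E, E) := ⟨F, hF.continuous⟩
  let cst : E →L[ℝ] C(Icc (0 : ℝ) 1, E) :=
    LinearMap.mkContinuous { toFun := fun z ↦ ContinuousMap.const _ z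
                             map_add' := fun _ _ ↦ rfl
                             map_smul' := fun _ _ ↦ rfl } 1 (fun z ↦ by
      rw [ContinuousMap.norm_le _ (by positivity), one_mul]
      exact fun _ ↦ le_rfl)
  let f : (E × ℝ) × C(Icc (0 : ℝ) 1, E) → C(Icc (0 : ℝ) 1, E) := fun p ↦
    p.2 - cst p.1.1 - p.1.2 • unitIntegralL E (F₀.comp p.2)
  have hf : ContDiff ℝ m f := by
    have h1 := (contDiff_continuousMap_comp (K := Icc (0 : ℝ) 1) m F₀ hF)
    have h2 : ContDiff ℝ m fun p : (E × ℝ) × C(Icc (0 : ℝ) 1, E) ↦ F₀.comp p.2 :=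
      h1.comp contDiff_snd
    fun_prop
  let u : (E × ℝ) × C(Icc (0 : ℝ) 1, E) := ((z₀, 0), cst z₀)
  have hfu : f u = 0 := by simp [f, u]
  have hm' : (m : ℕ∞ω) ≠ 0 := by exact_mod_cast hm
  have hd : fderiv ℝ f u ∘L .inr ℝ (E × ℝ) C(Icc (0 : ℝ) 1, E) = .id ℝ _ := by
    have h1 : HasFDerivAt (f ∘ fun γ ↦ ((z₀, (0 : ℝ)), γ))
        (fderiv ℝ f u ∘L .inr ℝ (E × ℝ) C(Icc (0 : ℝ) 1, E)) (cst z₀) :=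
      ((hf.differentiable hm') u).hasFDerivAt.comp (cst z₀) (hasFDerivAt_prodMk_right _ _)
    have h2 : (f ∘ fun γ ↦ ((z₀, (0 : ℝ)), γ)) = fun γ ↦ γ - cst z₀ := by
      ext γ; simp [f]
    rw [h2] at h1
    exact h1.unique ((hasFDerivAt_id _).sub_const _)
  have hinv : (fderiv ℝ f u ∘L .inr ℝ (E × ℝ) C(Icc (0 : ℝ) 1, E)).IsInvertible := by
    rw [hd]
    exact ⟨.refl ℝ _, rfl⟩
  let g := hf.contDiffAt.implicitFunction (u := u) hm' hinv
  have hg : ContDiffAt ℝ m g (z₀, 0) := hf.contDiffAt.contDiffAt_implicitFunction hm' hinv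
  have huniq := hf.contDiffAt.eventually_apply_eq_iff_implicitFunction (u := u) hm' hinv
  obtain ⟨η, hη, hball⟩ := Metric.eventually_nhds_iff_ball.1 huniq
  obtain ⟨δ, hδ, hδα⟩ := Metric.continuousAt_iff.1 hcα (η / 2) (half_pos hη)
  have hev : α =ᶠ[𝓝 (z₀, 0)] fun p ↦ g p ⟨1, by simp⟩ := by
    have hpos : 0 < min (min (r : ℝ) ε) (min δ η) := by positivity
    filter_upwards [Metric.ball_mem_nhds (z₀, (0 : ℝ)) hpos] with p hp
    obtain ⟨z, t⟩ := p
    rw [Metric.mem_ball, Prod.dist_eq, max_lt_iff] at hp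
    simp only [lt_min_iff, dist_zero_right, Real.norm_eq_abs] at hp
    obtain ⟨⟨⟨hzr, hzε⟩, hzδ, hzη⟩, ⟨⟨htr, htε⟩, htδ, htη⟩⟩ := hp
    have hz' : z ∈ Metric.closedBall z₀ (r : ℝ) := Metric.ball_subset_closedBall hzr
    have hts : ∀ s ∈ Icc (0 : ℝ) 1, |t * s| ≤ |t| := fun s hs ↦ by
      rw [abs_mul, abs_of_nonneg hs.1]
      exact mul_le_of_le_one_right (abs_nonneg _) hs.2
    have hder : ∀ s ∈ Icc (0 : ℝ) 1, HasDerivAt (fun s ↦ α (z, t * s)) (t • F (α (z, t * s))) s := by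
      intro s hs
      have := hα' z hz' (t * s) (abs_lt.1 ((hts s hs).trans_lt htε))
      have h2 : HasDerivAt (fun s ↦ t * s) t s := by simpa using (hasDerivAt_id s).const_mul t
      exact this.scomp s h2
    let c : C(Icc (0 : ℝ) 1, E) := ⟨fun s ↦ α (z, t * s), by
      have : ContinuousOn (fun s ↦ α (z, t * s)) (Icc 0 1) :=
        fun s hs ↦ (hder s hs).continuousAt.continuousWithinAt
      exact this.domRestrict⟩
    have hcf : f ((z, t), c) = f u := by
      rw [hfu]
      ext s
      have hcont : ContinuousOn (fun s ↦ F (α (z, t * s))) (Icc 0 1) := hF.continuous.comp_continuousOn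
        (fun s hs ↦ (hder s hs).continuousAt.continuousWithinAt)
      have hsub : uIcc (0 : ℝ) s ⊆ Icc 0 1 := by
        rw [uIcc_of_le s.2.1]; exact Icc_subset_Icc_right s.2.2
      have hint : ∫ σ in (0 : ℝ)..s, t • F (α (z, t * σ)) = α (z, t * s) - α (z, t * 0) :=
        intervalIntegral.integral_eq_sub_of_hasDerivAt (fun σ hσ ↦ hder σ (hsub hσ))
          ((hcont.mono hsub).const_smul t).intervalIntegrable
      have hcongr : ∫ σ in (0 : ℝ)..s, F₀.comp c (projIcc 0 1 zero_le_one σ)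
          = ∫ σ in (0 : ℝ)..s, F (α (z, t * σ)) := by
        refine intervalIntegral.integral_congr fun σ hσ ↦ ?_
        rw [projIcc_of_mem zero_le_one (hsub hσ)]
        rfl
      have : f ((z, t), c) s = α (z, t * s) - z - t • ∫ σ in (0 : ℝ)..s, F (α (z, t * σ)) := by
        rw [← hcongr, ← unitIntegralL_apply]
        rfl
      rw [this, ← intervalIntegral.integral_smul, hint, mul_zero, (hα z hz').1]
      simp
    have hcball : ((z, t), c) ∈ Metric.ball u η := by
      rw [Metric.mem_ball, Prod.dist_eq, max_lt_iff]
      refine ⟨?_, ?_⟩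
      · rw [Prod.dist_eq, max_lt_iff]
        exact ⟨hzη, by simpa [u] using htη⟩
      · refine lt_of_le_of_lt ((ContinuousMap.dist_le (half_pos hη).le).2 fun s ↦ ?_) (half_lt_self hη)
        have h3 : dist (z, t * s) (z₀, (0 : ℝ)) < δ := by
          rw [Prod.dist_eq, max_lt_iff]
          refine ⟨hzδ, ?_⟩
          simpa using (hts s s.2).trans_lt htδ
        have := (hδα h3).le
        rw [hαz₀] at this
        exact this
    have := (hball _ hcball).1 hcf
    have h1 : g (z, t) = c := this
    rw [h1]
    change α (z, t) = α (z, t * 1)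
    rw [mul_one]
  refine ContDiffAt.congr_of_eventuallyEq ?_ hev
  exact (ContinuousMap.evalCLM ℝ (⟨1, by simp⟩ : Icc (0 : ℝ) 1)).contDiff.contDiffAt.comp _ hg

end SmoothFlow

section ManifoldFlow

universe u

variable {E : Type u} [NormedAddCommGroup E] [NormedSpace ℝ E]
  {H : Type*} [TopologicalSpace H] {I : ModelWithCorners ℝ E H}
  {N : Type*} [TopologicalSpace N] [ChartedSpace H N]

/-- A vector field read in the chart at `p₀`. -/
noncomputable def chartField [IsManifold I 1 N] (v : (p : N) → TangentSpace I p) (p₀ : N) (z : E) : E :=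
  tangentCoordChange I ((extChartAt I p₀).symm z) p₀ ((extChartAt I p₀).symm z)
    (v ((extChartAt I p₀).symm z))

variable (I) in
/-- A vector field is smooth if its expression in every chart is. -/
def IsSmoothField [IsManifold I 1 N] (v : (p : N) → TangentSpace I p) : Prop :=
  ∀ p₀, ContDiffOn ℝ ∞ (chartField v p₀) (extChartAt I p₀).target

lemma IsSmoothField.contMDiff [IsManifold I ∞ N] [IsManifold I 1 N] {v : (p : N) → TangentSpace I p}
    [I.Boundaryless] (hv : IsSmoothField I v) :
    ContMDiff I I.tangent 1 (fun p ↦ (⟨p, v p⟩ : TangentBundle I N)) := by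
  intro p₀
  rw [Bundle.contMDiffAt_section]
  have h1 : ContMDiffAt I 𝓘(ℝ, E) 1 (chartField v p₀ ∘ extChartAt I p₀) p₀ := by
    refine ContMDiffAt.comp p₀ (I' := 𝓘(ℝ, E)) ?_ ((contMDiffAt_extChartAt (n := 1)))
    refine ContDiffAt.contMDiffAt ?_
    exact (((hv p₀).contDiffAt (extChartAt_target_mem_nhds (I := I) p₀)).of_le (by simp))
  refine h1.congr_of_eventuallyEq ?_
  filter_upwards [extChartAt_source_mem_nhds (I := I) p₀] with p hp
  have key : ∀ q, q = p → (trivializationAt E (TangentSpace I) p₀ ⟨p, v p⟩).2 =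
      tangentCoordChange I q p₀ q (v q) := by
    rintro q rfl
    rfl
  exact key _ ((extChartAt I p₀).left_inv hp)

lemma isMIntegralCurveOn_of_chart [IsManifold I 1 N] [I.Boundaryless]
    {v : (p : N) → TangentSpace I p} {p₀ : N} {s : Set ℝ} {c : ℝ → E}
    (hc : ∀ t ∈ s, c t ∈ (extChartAt I p₀).target)
    (hd : ∀ t ∈ s, HasDerivAt c (chartField v p₀ (c t)) t) :
    IsMIntegralCurveOn (fun t ↦ (extChartAt I p₀).symm (c t)) v s := by
  intro t ht
  have hf3' := hc t ht
  have h := hd t ht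
  unfold chartField at h
  let xₜ : N := (extChartAt I p₀).symm (c t)
  have hft1 := mem_preimage.mp <|
    mem_of_mem_of_subset hf3' (extChartAt I p₀).target_subset_preimage_source
  have hft2 := mem_extChartAt_source (I := I) xₜ
  apply HasMFDerivAt.hasMFDerivWithinAt
  obtain ⟨w, hw⟩ : ∃ w : E, w = v xₜ := ⟨_, rfl⟩
  have h : HasDerivAt c (tangentCoordChange I xₜ p₀ xₜ w) t := hw ▸ h
  have key : HasDerivAt ((extChartAt I xₜ ∘ (extChartAt I p₀).symm) ∘ c) w t := by
    have e : tangentCoordChange I p₀ xₜ xₜ (tangentCoordChange I xₜ p₀ xₜ w) = w := by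
      rw [tangentCoordChange_comp (x := p₀) ⟨⟨hft2, hft1⟩, hft2⟩, tangentCoordChange_self hft2]
    rw [← e]
    refine HasFDerivAt.comp_hasDerivAt _ ?_ h
    refine HasFDerivWithinAt.hasFDerivAt (s := range I) ?_ (by simp [I.range_eq_univ])
    rw [← (extChartAt I p₀).right_inv hf3']
    exact hasFDerivWithinAt_tangentCoordChange ⟨hft1, hft2⟩
  refine ⟨(continuousAt_extChartAt_symm'' hf3').comp h.continuousAt, ?_⟩
  have key' : HasFDerivWithinAt ((extChartAt I xₜ ∘ (extChartAt I p₀).symm) ∘ c)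
      ((1 : ℝ →L[ℝ] ℝ).smulRight w) (range 𝓘(ℝ, ℝ)) t :=
    (hasDerivAt_iff_hasFDerivAt.1 key).hasFDerivWithinAt.congr_fderiv (by ext; simp)
  rw [hw] at key'
  exact key'

lemma exists_contDiff_eventuallyEq {E G : Type*} [NormedAddCommGroup E] [NormedSpace ℝ E]
    [FiniteDimensional ℝ E] [NormedAddCommGroup G] [NormedSpace ℝ G] {F : E → G} {W : Set E}
    (hW : IsOpen W) (hF : ContDiffOn ℝ ∞ F W) {z₀ : E} (hz₀ : z₀ ∈ W) :
    ∃ F' : E → G, ContDiff ℝ ∞ F' ∧ F' =ᶠ[𝓝 z₀] F := by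
  obtain ⟨r, hr, hrW⟩ := Metric.nhds_basis_closedBall.mem_iff.1 (hW.mem_nhds hz₀)
  let χ : ContDiffBump z₀ := ⟨r / 2, r, half_pos hr, half_lt_self hr⟩
  refine ⟨fun z ↦ χ z • F z, contDiff_iff_contDiffAt.2 fun z ↦ ?_, ?_⟩
  · by_cases hz : z ∈ W
    · exact χ.contDiff.contDiffAt.smul (hF.contDiffAt (hW.mem_nhds hz))
    · have hz' : z ∉ tsupport χ := by
        rw [χ.tsupport_eq]
        exact fun h ↦ hz (hrW h)
      refine (contDiffAt_const (c := (0 : G))).congr_of_eventuallyEq ?_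
      filter_upwards [(isClosed_tsupport χ).isOpen_compl.mem_nhds hz'] with y hy
      rw [image_eq_zero_of_notMem_tsupport hy, zero_smul]
  · filter_upwards [χ.eventuallyEq_one] with z hz
    simp [hz]

/-- Local flow boxes of a smooth vector field, read in a chart. -/
theorem IsSmoothField.exists_localFlow [FiniteDimensional ℝ E] [IsManifold I ∞ N]
    [IsManifold I 1 N] [I.Boundaryless] {v : (p : N) → TangentSpace I p} (hv : IsSmoothField I v)
    (p₀ : N) {m : ℕ} (hm : m ≠ 0) :
    ∃ Ψ : E × ℝ → E, ∃ U : Set E, IsOpen U ∧ extChartAt I p₀ p₀ ∈ U ∧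
      U ⊆ (extChartAt I p₀).target ∧ ∃ δ > 0,
      ∀ z ∈ U, Ψ (z, 0) = z ∧ ∀ t ∈ Ioo (-δ) δ, Ψ (z, t) ∈ (extChartAt I p₀).target ∧
        HasDerivAt (fun t ↦ Ψ (z, t)) (chartField v p₀ (Ψ (z, t))) t ∧
        ContDiffAt ℝ m Ψ (z, t) := by
  have : CompleteSpace E := FiniteDimensional.complete ℝ E
  have htgt : IsOpen (extChartAt I p₀).target := isOpen_extChartAt_target p₀
  obtain ⟨F', hF', hFF'⟩ := exists_contDiff_eventuallyEq htgt (hv p₀)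
    (mem_extChartAt_target (I := I) p₀)
  obtain ⟨Ψ, hΨ, δ, hδ, hΨδ⟩ := exists_contDiffAt_localFlow hm
    (hF'.of_le (by exact_mod_cast le_top)) (extChartAt I p₀ p₀)
  have hΨ0 : Ψ (extChartAt I p₀ p₀, 0) = extChartAt I p₀ p₀ :=
    (hΨδ _ (Metric.mem_ball_self hδ)).1
  have h1 : ∀ᶠ y in 𝓝 (extChartAt I p₀ p₀, (0 : ℝ)), Ψ y ∈ (extChartAt I p₀).target ∧
      F' (Ψ y) = chartField v p₀ (Ψ y) ∧ ContDiffAt ℝ m Ψ y := by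
    have hc := hΨ.continuousAt
    refine (hc.eventually_mem ?_).and ((?_ : ∀ᶠ y in _, _).and
      (hΨ.eventually (by simp)))
    · rw [hΨ0]
      exact extChartAt_target_mem_nhds p₀
    · refine hc.eventually (p := fun w ↦ F' w = chartField v p₀ w) ?_
      rw [hΨ0]
      exact hFF'
  obtain ⟨η, hη, hball⟩ := Metric.eventually_nhds_iff_ball.1 h1
  refine ⟨Ψ, Metric.ball (extChartAt I p₀ p₀) (min δ η) ∩ (extChartAt I p₀).target,
    Metric.isOpen_ball.inter htgt, ⟨Metric.mem_ball_self (lt_min hδ hη), mem_extChartAt_target p₀⟩,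
    inter_subset_right, min δ η, lt_min hδ hη, fun z hz ↦ ?_⟩
  have hz1 : z ∈ Metric.ball (extChartAt I p₀ p₀) δ :=
    Metric.ball_subset_ball (min_le_left _ _) hz.1
  refine ⟨(hΨδ z hz1).1, fun t ht ↦ ?_⟩
  have htt := abs_lt.2 ht
  have hzt : (z, t) ∈ Metric.ball (extChartAt I p₀ p₀, (0 : ℝ)) η := by
    rw [Metric.mem_ball, Prod.dist_eq, max_lt_iff]
    exact ⟨Metric.ball_subset_ball (min_le_right _ _) hz.1, by
      simpa using htt.trans_le (min_le_right _ _)⟩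
  obtain ⟨h2, h3, h4⟩ := hball _ hzt
  refine ⟨h2, ?_, h4⟩
  rw [← h3]
  exact (hΨδ z hz1).2 t (abs_lt.1 (htt.trans_le (min_le_left _ _)))

/-- A smooth vector field vanishing outside a compact set is complete. -/
theorem IsSmoothField.exists_isMIntegralCurve [FiniteDimensional ℝ E] [IsManifold I ∞ N]
    [IsManifold I 1 N] [I.Boundaryless] [T2Space N] {v : (p : N) → TangentSpace I p}
    (hv : IsSmoothField I v) {K : Set N} (hK : IsCompact K) (hvK : ∀ p ∉ K, v p = 0) (p : N) :
    ∃ γ : ℝ → N, γ 0 = p ∧ IsMIntegralCurve γ v := by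
  have hloc : ∀ p₀ : N, ∃ U ∈ 𝓝 p₀, ∃ δ > (0 : ℝ), ∀ q ∈ U, ∃ γ : ℝ → N, γ 0 = q ∧
      IsMIntegralCurveOn γ v (Ioo (-δ) δ) := by
    intro p₀
    obtain ⟨Ψ, U, hU, hp₀, hUt, δ, hδ, hΨ⟩ := hv.exists_localFlow p₀ one_ne_zero
    refine ⟨(extChartAt I p₀).source ∩ extChartAt I p₀ ⁻¹' U,
      inter_mem (extChartAt_source_mem_nhds p₀)
        ((continuousAt_extChartAt p₀).preimage_mem_nhds (hU.mem_nhds hp₀)), δ, hδ, fun q hq ↦ ?_⟩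
    refine ⟨fun t ↦ (extChartAt I p₀).symm (Ψ (extChartAt I p₀ q, t)), ?_,
      isMIntegralCurveOn_of_chart (fun t ht ↦ ((hΨ _ hq.2).2 t ht).1)
        (fun t ht ↦ ((hΨ _ hq.2).2 t ht).2.1)⟩
    change (extChartAt I p₀).symm (Ψ (extChartAt I p₀ q, 0)) = q
    rw [(hΨ _ hq.2).1, (extChartAt I p₀).left_inv hq.1]
  have hunif : ∃ δ > (0 : ℝ), ∀ q ∈ K, ∃ γ : ℝ → N, γ 0 = q ∧
      IsMIntegralCurveOn γ v (Ioo (-δ) δ) := by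
    refine hK.induction_on (p := fun K ↦ ∃ δ > (0 : ℝ), ∀ q ∈ K, ∃ γ : ℝ → N, γ 0 = q ∧
      IsMIntegralCurveOn γ v (Ioo (-δ) δ)) ⟨1, one_pos, by simp⟩ ?_ ?_ ?_
    · rintro s t hst ⟨δ, hδ, h⟩
      exact ⟨δ, hδ, fun q hq ↦ h q (hst hq)⟩
    · rintro s t ⟨δ, hδ, h⟩ ⟨δ', hδ', h'⟩
      refine ⟨min δ δ', lt_min hδ hδ', ?_⟩
      rintro q (hq | hq)
      · obtain ⟨γ, h0, h1⟩ := h q hq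
        exact ⟨γ, h0, h1.mono (Ioo_subset_Ioo (neg_le_neg (min_le_left _ _)) (min_le_left _ _))⟩
      · obtain ⟨γ, h0, h1⟩ := h' q hq
        exact ⟨γ, h0, h1.mono (Ioo_subset_Ioo (neg_le_neg (min_le_right _ _)) (min_le_right _ _))⟩
    · intro q _
      obtain ⟨U, hU, h⟩ := hloc q
      exact ⟨U, mem_nhdsWithin_of_mem_nhds hU, h⟩
  obtain ⟨δ, hδ, h⟩ := hunif
  refine exists_isMIntegralCurve_of_isMIntegralCurveOn hv.contMDiff hδ (fun q ↦ ?_) p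
  by_cases hq : q ∈ K
  · exact h q hq
  · exact ⟨fun _ ↦ q, rfl, (isMIntegralCurve_const (hvK q hq)).isMIntegralCurveOn _⟩

/-- A property of the time-`t` maps of a flow, stable under composition, holds for all times if
it holds locally for short times. -/
lemma flow_induction {N : Type*} [TopologicalSpace N] {φ : ℝ → N → N}
    (hadd : ∀ s t p, φ (s + t) p = φ t (φ s p)) (hcont : ∀ p, Continuous fun t ↦ φ t p)
    (P : ℝ → N → Prop) (hcomp : ∀ s t p, P s p → P t (φ s p) → P (s + t) p)
    (hloc : ∀ p₀, ∃ U ∈ 𝓝 p₀, ∃ δ > 0, ∀ q ∈ U, ∀ t ∈ Ioo (-δ) δ, P t q)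
    (h0 : ∀ p, φ 0 p = p) (t : ℝ) (p : N) : P t p := by
  have key : P (t - 0) (φ 0 p) := by
    refine isPreconnected_univ.induction₂' (fun a b ↦ P (b - a) (φ a p)) (fun a _ ↦ ?_)
      (fun a b c _ _ _ hab hbc ↦ ?_) (mem_univ (0 : ℝ)) (mem_univ t)
    · obtain ⟨U, hU, δ, hδ, h⟩ := hloc (φ a p)
      rw [nhdsWithin_univ]
      filter_upwards [(hcont p).continuousAt.preimage_mem_nhds hU, Metric.ball_mem_nhds a hδ]
        with b hb hba
      rw [Metric.mem_ball, Real.dist_eq, abs_lt] at hba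
      exact ⟨h _ (mem_of_mem_nhds hU) _ hba, h _ hb _ ⟨by linarith [hba.2], by linarith [hba.1]⟩⟩
    · have := hcomp (b - a) (c - b) (φ a p) hab (by
        rw [← hadd, add_sub_cancel]; exact hbc)
      rwa [sub_add_sub_cancel'] at this
  rwa [sub_zero, h0] at key

lemma IsSmoothField.flow_add [IsManifold I ∞ N]
    [IsManifold I 1 N] [I.Boundaryless] [T2Space N] {v : (p : N) → TangentSpace I p}
    (hv : IsSmoothField I v) {φ : ℝ → N → N} (h0 : ∀ p, φ 0 p = p)
    (hφ : ∀ p, IsMIntegralCurve (I := I) (fun t ↦ φ t p) v) (s t : ℝ) (p : N) :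
    φ (s + t) p = φ t (φ s p) := by
  have h1 := (hφ p).comp_add s
  have h2 := isMIntegralCurve_Ioo_eq_of_contMDiff_boundaryless (t₀ := 0) hv.contMDiff h1 (hφ (φ s p))
    (by simp [h0])
  have := congrFun h2 t
  simpa [add_comm] using this

/-- The flow of a smooth vector field agrees with its local flow boxes. -/
lemma IsSmoothField.flow_eq_localFlow [IsManifold I ∞ N]
    [IsManifold I 1 N] [I.Boundaryless] [T2Space N] {v : (p : N) → TangentSpace I p}
    (hv : IsSmoothField I v) {φ : ℝ → N → N} (h0 : ∀ p, φ 0 p = p)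
    (hφ : ∀ p, IsMIntegralCurve (I := I) (fun t ↦ φ t p) v) {p₀ : N} {c : ℝ → E} {δ : ℝ}
    (hc : ∀ t ∈ Ioo (-δ) δ, c t ∈ (extChartAt I p₀).target)
    (hd : ∀ t ∈ Ioo (-δ) δ, HasDerivAt c (chartField v p₀ (c t)) t) {t : ℝ}
    (ht : t ∈ Ioo (-δ) δ) :
    φ t ((extChartAt I p₀).symm (c 0)) = (extChartAt I p₀).symm (c t) := by
  have hδ : (0 : ℝ) ∈ Ioo (-δ) δ := by constructor <;> linarith [ht.1, ht.2]
  exact isMIntegralCurveOn_Ioo_eqOn_of_contMDiff_boundaryless hδ hv.contMDiff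
    ((hφ _).isMIntegralCurveOn _) (isMIntegralCurveOn_of_chart hc hd) (h0 _) ht

end ManifoldFlow

section PhaseSpace

/-- The standard symplectic form on `V × V*`. -/
def stdTwoForm {V : Type*} [NormedAddCommGroup V] [NormedSpace ℝ V] (v w : V × (V →L[ℝ] ℝ)) : ℝ :=
  v.2 w.1 - w.2 v.1

/-- If `ν` is the pull-back of `∑ ξⱼ dxⱼ` under `j`, then `dν` is the pull-back of the standard
symplectic form. -/
lemma stdTwoForm_fderiv {V E₁ : Type*} [NormedAddCommGroup V] [NormedSpace ℝ V]
    [NormedAddCommGroup E₁] [NormedSpace ℝ E₁] {j : E₁ → V × (V →L[ℝ] ℝ)} {u : E₁}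
    (hj : ContDiffAt ℝ 2 j u) {ν : E₁ → E₁ →L[ℝ] ℝ}
    (hν : ∀ᶠ u' in 𝓝 u, ∀ w, ν u' w = (j u').2 (fderiv ℝ j u' w).1) (v w : E₁) :
    stdTwoForm (fderiv ℝ j u v) (fderiv ℝ j u w) = fderiv ℝ ν u v w - fderiv ℝ ν u w v := by
  have ha : ContDiffAt ℝ 2 (fun x ↦ (j x).1) u := contDiffAt_fst.comp u hj
  have hb : ContDiffAt ℝ 2 (fun x ↦ (j x).2) u := contDiffAt_snd.comp u hj
  have hjd : ∀ᶠ x in 𝓝 u, DifferentiableAt ℝ j x :=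
    (hj.eventually (by simp)).mono fun x hx ↦ hx.differentiableAt (by simp)
  have hfst : ∀ x, DifferentiableAt ℝ j x → ∀ w, (fderiv ℝ j x w).1 = fderiv ℝ (fun x ↦ (j x).1) x w :=
    fun x hx w ↦ by rw [hx.hasFDerivAt.fst.fderiv]; rfl
  have hsnd : ∀ w, (fderiv ℝ j u w).2 = fderiv ℝ (fun x ↦ (j x).2) u w :=
    fun w ↦ by rw [hjd.self_of_nhds.hasFDerivAt.snd.fderiv]; rfl
  have h1 : ν =ᶠ[𝓝 u] fun u' ↦ (j u').2.comp (fderiv ℝ (fun x ↦ (j x).1) u') := by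
    filter_upwards [hν, hjd] with u' hu' hd
    ext w
    simp [hu' w, hfst u' hd]
  have hd2 : HasFDerivAt (fderiv ℝ (fun x ↦ (j x).1)) (fderiv ℝ (fderiv ℝ (fun x ↦ (j x).1)) u) u :=
    ((ha.fderiv_right (m := 1) (by norm_num)).differentiableAt (by simp)).hasFDerivAt
  have h2 := ((hb.differentiableAt (by simp)).hasFDerivAt.clm_comp hd2).congr_of_eventuallyEq h1
  have hs : fderiv ℝ (fderiv ℝ (fun x ↦ (j x).1)) u v w = fderiv ℝ (fderiv ℝ (fun x ↦ (j x).1)) u w v :=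
    (ha.isSymmSndFDerivAt (by simp)) v w
  rw [h2.fderiv, stdTwoForm, hsnd, hsnd, hfst _ hjd.self_of_nhds, hfst _ hjd.self_of_nhds]
  simp [hs]

lemma stdTwoForm_left_unique {V : Type*} [NormedAddCommGroup V] [InnerProductSpace ℝ V]
    [CompleteSpace V] {v : V × (V →L[ℝ] ℝ)} {l : V × (V →L[ℝ] ℝ) →L[ℝ] ℝ}
    (h : ∀ u, stdTwoForm v u = - l u) :
    v = ((InnerProductSpace.toDual ℝ V).symm ((l.comp (ContinuousLinearMap.inr ℝ V (V →L[ℝ] ℝ))).comp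
      (InnerProductSpace.toDual ℝ V).toContinuousLinearEquiv.toContinuousLinearMap),
      -(l.comp (ContinuousLinearMap.inl ℝ V (V →L[ℝ] ℝ)))) := by
  refine Prod.ext ?_ ?_
  · rw [LinearIsometryEquiv.eq_symm_apply]
    ext u
    have := h (0, InnerProductSpace.toDual ℝ V u)
    simp only [stdTwoForm, map_zero, zero_sub, neg_inj] at this
    simp only [InnerProductSpace.toDual_apply_apply] at this ⊢
    rw [real_inner_comm, this]
    rfl
  · ext u
    have := h (u, 0)
    simpa [stdTwoForm] using this

end PhaseSpace

section CotangentCharts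

variable {n : ℕ} {M : Type*} [TopologicalSpace M] [ChartedSpace (EuclideanSpace ℝ (Fin n)) M]
  [IsManifold (𝓡 n) ∞ M]

/-- The model space `ℝⁿ × (ℝⁿ)*` of the cotangent bundle. -/
abbrev PhaseSpace (n : ℕ) : Type :=
  EuclideanSpace ℝ (Fin n) × (EuclideanSpace ℝ (Fin n) →L[ℝ] ℝ)

section Charts

variable {E : Type*} [NormedAddCommGroup E] [NormedSpace ℝ E]
  {H : Type*} [TopologicalSpace H] {I : ModelWithCorners ℝ E H}
  {N : Type*} [TopologicalSpace N] [ChartedSpace H N] [IsManifold I 1 N]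

lemma mfderiv_extChartAt_eq_tangentCoordChange {p₀ q : N} (hq : q ∈ (extChartAt I p₀).source) :
    mfderiv I 𝓘(ℝ, E) (extChartAt I p₀) q = tangentCoordChange I q p₀ q := by
  have h : MDifferentiableAt I 𝓘(ℝ, E) (extChartAt I p₀) q :=
    mdifferentiableAt_extChartAt (by rwa [← extChartAt_source I])
  exact h.mfderiv

variable [I.Boundaryless]

lemma mdifferentiableAt_extChartAt_symm {p₀ : N} {z : E} (hz : z ∈ (extChartAt I p₀).target) :
    MDifferentiableAt 𝓘(ℝ, E) I (extChartAt I p₀).symm z := by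
  have := mdifferentiableWithinAt_extChartAt_symm (I := I) hz
  rwa [ModelWithCorners.range_eq_univ, mdifferentiableWithinAt_univ] at this

lemma mfderiv_symm_apply_mfderiv_extChartAt {p₀ : N} {z : E} (hz : z ∈ (extChartAt I p₀).target)
    (w : TangentSpace I ((extChartAt I p₀).symm z)) :
    mfderiv 𝓘(ℝ, E) I (extChartAt I p₀).symm z
      (mfderiv I 𝓘(ℝ, E) (extChartAt I p₀) ((extChartAt I p₀).symm z) w) = w := by
  have h := mfderivWithin_extChartAt_symm_comp_mfderiv_extChartAt (I := I) hz
  rw [ModelWithCorners.range_eq_univ, mfderivWithin_univ] at h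
  exact DFunLike.congr_fun h w

lemma mfderiv_extChartAt_apply_mfderiv_symm {p₀ : N} {z : E} (hz : z ∈ (extChartAt I p₀).target)
    (u : TangentSpace 𝓘(ℝ, E) z) :
    mfderiv I 𝓘(ℝ, E) (extChartAt I p₀) ((extChartAt I p₀).symm z)
      (mfderiv 𝓘(ℝ, E) I (extChartAt I p₀).symm z u) = u := by
  have h := mfderiv_extChartAt_comp_mfderivWithin_extChartAt_symm (I := I) hz
  rw [ModelWithCorners.range_eq_univ, mfderivWithin_univ] at h
  exact DFunLike.congr_fun h u

end Charts

lemma canonicalOneForm_eq_chart {p₀ q : Cotangent n M}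
    (hq : q ∈ (extChartAt (cotangentModel n) p₀).source)
    (w : TangentSpace (cotangentModel n) q) (w' : PhaseSpace n)
    (hw' : w' = mfderiv (cotangentModel n) 𝓘(ℝ, PhaseSpace n) (extChartAt (cotangentModel n) p₀) q w) :
    canonicalOneForm q w = (extChartAt (cotangentModel n) p₀ q).2 w'.1 := by
  obtain ⟨z, hz, rfl⟩ : ∃ z ∈ (extChartAt (cotangentModel n) p₀).target,
      q = (extChartAt (cotangentModel n) p₀).symm z :=
    ⟨_, (extChartAt _ p₀).map_source hq, ((extChartAt _ p₀).left_inv hq).symm⟩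
  have h := DFunLike.congr_fun (canonicalOneFormInChart_eq p₀ _ hz) w'
  have h2 : mfderiv 𝓘(ℝ, PhaseSpace n) (cotangentModel n) (extChartAt (cotangentModel n) p₀).symm z w'
      = w := by
    rw [hw']
    exact mfderiv_symm_apply_mfderiv_extChartAt hz w
  rw [(extChartAt (cotangentModel n) p₀).right_inv hz]
  refine Eq.trans ?_ h
  rw [← h2]
  rfl

lemma canonicalTwoForm_eq_chart {p₀ q : Cotangent n M}
    (hq : q ∈ (extChartAt (cotangentModel n) p₀).source)
    (v w : TangentSpace (cotangentModel n) q) (v' w' : PhaseSpace n)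
    (hv' : v' = mfderiv (cotangentModel n) 𝓘(ℝ, PhaseSpace n) (extChartAt (cotangentModel n) p₀) q v)
    (hw' : w' = mfderiv (cotangentModel n) 𝓘(ℝ, PhaseSpace n) (extChartAt (cotangentModel n) p₀) q w) :
    canonicalTwoForm q v w = stdTwoForm v' w' := by
  let e := extChartAt (cotangentModel n) p₀
  let e' := extChartAt (cotangentModel n) q
  let z := e' q
  let τ : PhaseSpace n → PhaseSpace n := e ∘ e'.symm
  have hD : mfderiv (cotangentModel n) 𝓘(ℝ, PhaseSpace n) (extChartAt (cotangentModel n) p₀) q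
      = fderiv ℝ τ z := by
    rw [mfderiv_extChartAt_eq_tangentCoordChange hq, tangentCoordChange_def,
      ModelWithCorners.range_eq_univ, fderivWithin_univ]
  have hzq : z ∈ (e'.symm ≫ e).source := by
    simp only [PartialEquiv.trans_source, PartialEquiv.symm_source, mem_inter_iff, mem_preimage]
    exact ⟨mem_extChartAt_target q, by
      change e'.symm (e' q) ∈ e.source
      rw [e'.left_inv (mem_extChartAt_source q)]; exact hq⟩
  have hτ : ContDiffAt ℝ ∞ τ z := by
    have := contDiffWithinAt_ext_coord_change (I := cotangentModel n) (n := ∞) p₀ q hzq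
    rwa [ModelWithCorners.range_eq_univ, contDiffWithinAt_univ] at this
  have hnhds : ∀ᶠ z' in 𝓝 z, z' ∈ e'.target ∧ e'.symm z' ∈ e.source := by
    refine Filter.Eventually.and (extChartAt_target_mem_nhds (I := cotangentModel n) q) ?_
    refine (continuousAt_extChartAt_symm (I := cotangentModel n) q).eventually_mem ?_
    rw [(extChartAt (cotangentModel n) q).left_inv (mem_extChartAt_source q)]
    exact extChartAt_source_mem_nhds' hq
  have key := stdTwoForm_fderiv (hτ.of_le (WithTop.coe_le_coe.2 le_top : ((2 : ℕ∞) : ℕ∞ω) ≤ ∞)) (u := z)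
    (ν := fun z ↦ z.2.comp (ContinuousLinearMap.fst ℝ _ _)) (by
      filter_upwards [hnhds] with z' hz' u
      have h1 := DFunLike.congr_fun (canonicalOneFormInChart_eq q _ hz'.1) u
      refine h1.symm.trans ?_
      have hs := mdifferentiableAt_extChartAt_symm hz'.1
      have he : MDifferentiableAt (cotangentModel n) 𝓘(ℝ, PhaseSpace n) e (e'.symm z') :=
        mdifferentiableAt_extChartAt (by rw [← extChartAt_source (cotangentModel n)]; exact hz'.2)
      have hc := DFunLike.congr_fun (mfderiv_comp z' he hs) u
      refine canonicalOneForm_eq_chart hz'.2 _ _ ?_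
      rw [← mfderiv_eq_fderiv]
      exact hc) v w
  have hν := HasFDerivAt.clm_comp (hasFDerivAt_snd (𝕜 := ℝ) (p := z))
      (hasFDerivAt_const (ContinuousLinearMap.fst ℝ (EuclideanSpace ℝ (Fin n))
        (EuclideanSpace ℝ (Fin n) →L[ℝ] ℝ)) z)
  rw [hν.fderiv] at key
  rw [hv', hw', hD]
  refine (canonicalTwoForm_apply q v w).trans (Eq.trans ?_ key.symm)
  simp
  rfl

end CotangentCharts

section HamiltonianFields

variable {n : ℕ} {M : Type*} [TopologicalSpace M] [ChartedSpace (EuclideanSpace ℝ (Fin n)) M]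
  [IsManifold (𝓡 n) ∞ M]

instance [T2Space M] : T2Space (Cotangent n M) := by
  refine ⟨fun p q hpq ↦ ?_⟩
  by_cases h : p.proj = q.proj
  · let e := trivializationAt (EuclideanSpace ℝ (Fin n) →L[ℝ] ℝ)
      (fun x : M ↦ TangentSpace (𝓡 n) x →L[ℝ] Bundle.Trivial M ℝ x) p.proj
    have hp : p ∈ e.source := e.mem_source.2 (mem_baseSet_trivializationAt _ _ _)
    have hq : q ∈ e.source := e.mem_source.2 (h ▸ mem_baseSet_trivializationAt _ _ _)
    obtain ⟨u, v, hu, hv, hpu, hqv, huv⟩ := t2_separation (e.injOn.ne hp hq hpq)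
    refine ⟨_, _, e.toOpenPartialHomeomorph.isOpen_inter_preimage hu,
      e.toOpenPartialHomeomorph.isOpen_inter_preimage hv, ⟨hp, hpu⟩, ⟨hq, hqv⟩, ?_⟩
    exact (huv.preimage _).mono inter_subset_right inter_subset_right
  · obtain ⟨u, v, hu, hv, hpu, hqv, huv⟩ := t2_separation h
    have hc : Continuous (TotalSpace.proj : Cotangent n M → M) := FiberBundle.continuous_proj _ _
    exact ⟨_, _, hu.preimage hc, hv.preimage hc, hpu, hqv, huv.preimage _⟩

lemma stdTwoForm_chartField_hamiltonianVectorField {H : Cotangent n M → ℝ} {p₀ : Cotangent n M}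
    {z : PhaseSpace n} (hz : z ∈ (extChartAt (cotangentModel n) p₀).target)
    (hH : MDifferentiableAt (cotangentModel n) 𝓘(ℝ, ℝ) H ((extChartAt (cotangentModel n) p₀).symm z))
    (u : PhaseSpace n) :
    stdTwoForm (chartField (I := cotangentModel n) (hamiltonianVectorField H) p₀ z) u
      = - fderiv ℝ (H ∘ (extChartAt (cotangentModel n) p₀).symm) z u := by
  have hq := (extChartAt (cotangentModel n) p₀).map_target hz
  have h1 := canonicalTwoForm_hamiltonianVectorField H ((extChartAt (cotangentModel n) p₀).symm z)
    (mfderiv 𝓘(ℝ, PhaseSpace n) (cotangentModel n) (extChartAt (cotangentModel n) p₀).symm z u)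
  rw [canonicalTwoForm_eq_chart hq _ _ _ u rfl (mfderiv_extChartAt_apply_mfderiv_symm hz u).symm,
    mfderiv_extChartAt_eq_tangentCoordChange hq] at h1
  refine Eq.trans h1 ?_
  rw [← mfderiv_eq_fderiv, mfderiv_comp z hH (mdifferentiableAt_extChartAt_symm hz)]
  rfl

lemma contDiffOn_comp_extChartAt_symm {H : Cotangent n M → ℝ}
    (hH : ContMDiff (cotangentModel n) 𝓘(ℝ, ℝ) ∞ H) (p₀ : Cotangent n M) :
    ContDiffOn ℝ ∞ (H ∘ (extChartAt (cotangentModel n) p₀).symm)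
      (extChartAt (cotangentModel n) p₀).target :=
  contMDiffOn_iff_contDiffOn.1 (hH.comp_contMDiffOn (contMDiffOn_extChartAt_symm p₀))

/-- The Hamiltonian vector field of a smooth function is smooth. -/
lemma isSmoothField_hamiltonianVectorField {H : Cotangent n M → ℝ}
    (hH : ContMDiff (cotangentModel n) 𝓘(ℝ, ℝ) ∞ H) :
    IsSmoothField (cotangentModel n) (hamiltonianVectorField H) := by
  intro p₀
  have htgt : IsOpen (extChartAt (cotangentModel n) p₀).target := isOpen_extChartAt_target p₀
  have h1 := (contDiffOn_comp_extChartAt_symm hH p₀).fderiv_of_isOpen (m := ∞) htgt (by simp)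
  refine ContDiffOn.congr (f := fun z ↦ (
    (InnerProductSpace.toDual ℝ (EuclideanSpace ℝ (Fin n))).symm
      (((fderiv ℝ (H ∘ (extChartAt (cotangentModel n) p₀).symm) z).comp
        (ContinuousLinearMap.inr ℝ _ _)).comp
        (InnerProductSpace.toDual ℝ (EuclideanSpace ℝ (Fin n))).toContinuousLinearEquiv.toContinuousLinearMap),
      -((fderiv ℝ (H ∘ (extChartAt (cotangentModel n) p₀).symm) z).comp
        (ContinuousLinearMap.inl ℝ _ _)))) ?_ (fun z hz ↦ ?_)
  · refine ContDiffOn.prodMk ?_ ?_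
    · refine (LinearIsometryEquiv.contDiff _).comp_contDiffOn ?_
      exact (h1.clm_comp contDiffOn_const).clm_comp contDiffOn_const
    · exact (h1.clm_comp contDiffOn_const).neg
  · exact stdTwoForm_left_unique (stdTwoForm_chartField_hamiltonianVectorField hz
      (hH.mdifferentiable (by simp) _))

/-- An immersion on which the canonical one-form is exact is Lagrangian. -/
lemma isPrimitive_pullback_canonicalTwoForm {L : Type*} [TopologicalSpace L]
    [ChartedSpace (EuclideanSpace ℝ (Fin n)) L] [IsManifold (𝓡 n) ∞ L]
    {j : L → Cotangent n M} (hj : ContMDiff (𝓡 n) (cotangentModel n) ∞ j) {f : L → ℝ}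
    (hf : IsPrimitive j f) (p : L) (v w : TangentSpace (𝓡 n) p) :
    canonicalTwoForm (j p) (mfderiv (𝓡 n) (cotangentModel n) j p v)
      (mfderiv (𝓡 n) (cotangentModel n) j p w) = 0 := by
  let e := extChartAt (𝓡 n) p
  let e' := extChartAt (cotangentModel n) (j p)
  let jc : EuclideanSpace ℝ (Fin n) → PhaseSpace n := e' ∘ j ∘ e.symm
  let u := e p
  have hjd : ∀ q, MDifferentiableAt (𝓡 n) (cotangentModel n) j q := hj.mdifferentiable (by simp)
  have hfd : ∀ q, MDifferentiableAt (𝓡 n) 𝓘(ℝ, ℝ) f q := hf.contMDiff.mdifferentiable (by simp)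
  have hev : ∀ᶠ u' in 𝓝 u, u' ∈ e.target ∧ j (e.symm u') ∈ e'.source := by
    refine Filter.Eventually.and (extChartAt_target_mem_nhds (I := 𝓡 n) p) ?_
    have hc : ContinuousAt (fun u' ↦ j (e.symm u')) u :=
      hj.continuous.continuousAt.comp (continuousAt_extChartAt_symm (I := 𝓡 n) p)
    refine hc.eventually_mem ?_
    change e'.source ∈ 𝓝 (j (e.symm (e p)))
    rw [e.left_inv (mem_extChartAt_source p)]
    exact extChartAt_source_mem_nhds _
  have hjc : ContDiffAt ℝ ∞ jc u := by
    have h1 := (contMDiffAt_iff.1 (hj p)).2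
    rw [ModelWithCorners.range_eq_univ, contDiffWithinAt_univ] at h1
    exact h1
  have hfc : ContDiffAt ℝ ∞ (f ∘ e.symm) u := by
    have h1 := (contMDiffAt_iff.1 (hf.contMDiff p)).2
    rw [ModelWithCorners.range_eq_univ, contDiffWithinAt_univ] at h1
    exact h1
  have h2 : (2 : ℕ∞ω) ≤ ∞ := (WithTop.coe_le_coe.2 le_top : ((2 : ℕ∞) : ℕ∞ω) ≤ ∞)
  have key := stdTwoForm_fderiv (hjc.of_le h2) (ν := fderiv ℝ (f ∘ e.symm)) (by
    filter_upwards [hev] with u' hu' w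
    have hs := mdifferentiableAt_extChartAt_symm hu'.1
    have he : MDifferentiableAt (cotangentModel n) 𝓘(ℝ, PhaseSpace n) e' (j (e.symm u')) :=
      mdifferentiableAt_extChartAt (by rw [← extChartAt_source (cotangentModel n)]; exact hu'.2)
    have h1 : fderiv ℝ (f ∘ e.symm) u' w = mfderiv (𝓡 n) 𝓘(ℝ, ℝ) f (e.symm u')
        (mfderiv 𝓘(ℝ, EuclideanSpace ℝ (Fin n)) (𝓡 n) e.symm u' w) := by
      rw [← mfderiv_eq_fderiv, mfderiv_comp u' (hfd _) hs]
      rfl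
    rw [h1, hf.mfderiv_eq]
    refine canonicalOneForm_eq_chart hu'.2 _ _ ?_
    rw [← mfderiv_eq_fderiv]
    exact DFunLike.congr_fun ((mfderiv_comp u' he ((hjd _).comp u' hs)).trans
      (congrArg _ (mfderiv_comp u' (hjd _) hs))) w) v w
  rw [(hfc.of_le h2).isSymmSndFDerivAt (by simp) v w, sub_self] at key
  refine Eq.trans ?_ key
  have hj' : mfderiv (𝓡 n) (cotangentModel n) j p = fderiv ℝ jc u := by
    rw [(hjd p).mfderiv, ModelWithCorners.range_eq_univ, fderivWithin_univ]
    rfl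
  rw [hj']
  exact canonicalTwoForm_apply (j p) _ _

end HamiltonianFields

section Variational

/-- The variational equation of a local flow. -/
lemma hasDerivAt_fderiv_localFlow {E : Type*} [NormedAddCommGroup E] [NormedSpace ℝ E]
    {Ψ : E × ℝ → E} {F : E → E} {U : Set E} (hU : IsOpen U) {δ : ℝ}
    (hΨ : ∀ z ∈ U, ∀ t ∈ Ioo (-δ) δ, HasDerivAt (fun t ↦ Ψ (z, t)) (F (Ψ (z, t))) t ∧
      ContDiffAt ℝ 2 Ψ (z, t))
    {z : E} (hz : z ∈ U) {t : ℝ} (ht : t ∈ Ioo (-δ) δ) (hF : DifferentiableAt ℝ F (Ψ (z, t)))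
    (v : E) :
    HasDerivAt (fun t ↦ fderiv ℝ Ψ (z, t) (v, 0))
      (fderiv ℝ F (Ψ (z, t)) (fderiv ℝ Ψ (z, t) (v, 0))) t := by
  have h2 := (hΨ z hz t ht).2
  have hB : HasFDerivAt (fderiv ℝ Ψ) (fderiv ℝ (fderiv ℝ Ψ) (z, t)) (z, t) :=
    ((h2.fderiv_right (m := 1) (by norm_num)).differentiableAt (by simp)).hasFDerivAt
  have hline : ∀ (y : E) (s : ℝ), HasDerivAt (fun s : ℝ ↦ (y, s)) ((0 : E), (1 : ℝ)) s := fun y s ↦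
    (hasDerivAt_const s y).prodMk (hasDerivAt_id s)
  have h3 : HasDerivAt (fun s ↦ fderiv ℝ Ψ (z, s)) (fderiv ℝ (fderiv ℝ Ψ) (z, t) (0, 1)) t :=
    hB.comp_hasDerivAt t (hline z t)
  have h4 := h3.clm_apply (hasDerivAt_const t ((v, 0) : E × ℝ))
  rw [map_zero, add_zero, h2.isSymmSndFDerivAt (by simp) (0, 1) (v, 0)] at h4
  have hev : (fun y ↦ fderiv ℝ Ψ y (0, 1)) =ᶠ[𝓝 (z, t)] F ∘ Ψ := by
    filter_upwards [prod_mem_nhds (hU.mem_nhds hz) (Ioo_mem_nhds ht.1 ht.2)] with y hy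
    obtain ⟨h5, h6⟩ := hΨ y.1 hy.1 y.2 hy.2
    have h7 := (h6.differentiableAt (by simp)).hasFDerivAt.comp_hasDerivAt y.2 (hline y.1 y.2)
    exact h7.unique h5
  have h8 : HasFDerivAt (F ∘ Ψ) ((fderiv ℝ F (Ψ (z, t))).comp (fderiv ℝ Ψ (z, t))) (z, t) :=
    hF.hasFDerivAt.comp (z, t) (h2.differentiableAt (by simp)).hasFDerivAt
  have h9 := hB.clm_apply (hasFDerivAt_const ((0, 1) : E × ℝ) (z, t))
  have h10 := DFunLike.congr_fun (h9.unique (h8.congr_of_eventuallyEq hev)) (v, 0)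
  have h11 : fderiv ℝ (fderiv ℝ Ψ) (z, t) (v, 0) (0, 1)
      = fderiv ℝ F (Ψ (z, t)) (fderiv ℝ Ψ (z, t) (v, 0)) := by
    simpa using h10
  rwa [h11] at h4

lemma fderiv_localFlow_slice {E : Type*} [NormedAddCommGroup E] [NormedSpace ℝ E]
    {Ψ : E × ℝ → E} {z : E} {t : ℝ} (h : DifferentiableAt ℝ Ψ (z, t)) :
    HasFDerivAt (fun z ↦ Ψ (z, t))
      ((fderiv ℝ Ψ (z, t)).comp (ContinuousLinearMap.inl ℝ E ℝ)) z :=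
  h.hasFDerivAt.comp z (hasFDerivAt_prodMk_left z t)

/-- A local Hamiltonian flow changes `∑ ξⱼ dxⱼ` by `t dk`, if `k = ∑ ξⱼ ∂H/∂ξⱼ - H` is constant
along the flow. -/
lemma localFlow_pullback_oneForm {V : Type*} [NormedAddCommGroup V] [NormedSpace ℝ V]
    {Ψ : (V × (V →L[ℝ] ℝ)) × ℝ → V × (V →L[ℝ] ℝ)} {F : V × (V →L[ℝ] ℝ) → V × (V →L[ℝ] ℝ)}
    {H k : V × (V →L[ℝ] ℝ) → ℝ} {U W : Set (V × (V →L[ℝ] ℝ))} (hU : IsOpen U) (hW : IsOpen W)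
    {δ : ℝ} (hΨ0 : ∀ z ∈ U, Ψ (z, 0) = z)
    (hΨ : ∀ z ∈ U, ∀ t ∈ Ioo (-δ) δ, HasDerivAt (fun t ↦ Ψ (z, t)) (F (Ψ (z, t))) t ∧
      ContDiffAt ℝ 2 Ψ (z, t))
    (hΨW : ∀ z ∈ U, ∀ t ∈ Ioo (-δ) δ, Ψ (z, t) ∈ W)
    (hF : ∀ w ∈ W, DifferentiableAt ℝ F w) (hH : ∀ w ∈ W, DifferentiableAt ℝ H w)
    (hFH : ∀ w ∈ W, ∀ u, stdTwoForm (F w) u = - fderiv ℝ H w u)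
    (hk : ∀ w ∈ W, k w = w.2 (F w).1 - H w)
    (hkΨ : ∀ z ∈ U, ∀ t ∈ Ioo (-δ) δ, k (Ψ (z, t)) = k z)
    {z : V × (V →L[ℝ] ℝ)} (hz : z ∈ U) {t : ℝ} (ht : t ∈ Ioo (-δ) δ) (v : V × (V →L[ℝ] ℝ)) :
    (Ψ (z, t)).2 (fderiv ℝ (fun z ↦ Ψ (z, t)) z v).1 = z.2 v.1 + t * fderiv ℝ k z v := by
  let D : ℝ → V × (V →L[ℝ] ℝ) := fun t ↦ fderiv ℝ Ψ (z, t) (v, 0)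
  have hslice : ∀ t ∈ Ioo (-δ) δ, fderiv ℝ (fun z ↦ Ψ (z, t)) z v = D t := fun t ht ↦ by
    rw [(fderiv_localFlow_slice ((hΨ z hz t ht).2.differentiableAt (by simp))).fderiv]
    simp [D]
  have hδ : (0 : ℝ) ∈ Ioo (-δ) δ := by constructor <;> linarith [ht.1, ht.2]
  have hkd : ∀ w ∈ W, ∀ u, HasFDerivAt k (fderiv ℝ k w) w ∧
      fderiv ℝ k w u = w.2 (fderiv ℝ F w u).1 + (F w).2 u.1 := by
    intro w hw u
    have h1 : HasFDerivAt (fun w ↦ w.2 (F w).1 - H w) _ w :=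
      ((hasFDerivAt_snd (𝕜 := ℝ) (p := w)).clm_apply (hF w hw).hasFDerivAt.fst).sub
        (hH w hw).hasFDerivAt
    have h2 := h1.congr_of_eventuallyEq (f₁ := k) (by
      filter_upwards [hW.mem_nhds hw] with w' hw' using hk w' hw')
    refine ⟨h2.differentiableAt.hasFDerivAt, ?_⟩
    rw [h2.fderiv]
    have h3 := hFH w hw u
    simp only [stdTwoForm] at h3
    simp
    linarith
  have hconst : ∀ t ∈ Ioo (-δ) δ, fderiv ℝ k (Ψ (z, t)) (D t) = fderiv ℝ k z v := by
    intro t ht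
    have h1 := (hkd _ (hΨW z hz t ht) 0).1.comp z
      (fderiv_localFlow_slice ((hΨ z hz t ht).2.differentiableAt (by simp)))
    have h2 : (k ∘ fun z ↦ Ψ (z, t)) =ᶠ[𝓝 z] k := by
      filter_upwards [hU.mem_nhds hz] with y hy using hkΨ y hy t ht
    rw [(h1.congr_of_eventuallyEq h2.symm).fderiv]
    simp [D]
  have hder : ∀ t ∈ Ioo (-δ) δ, HasDerivAt (fun t ↦ (Ψ (z, t)).2 (D t).1 - t * fderiv ℝ k z v) 0 t := by
    intro t ht
    have h1 := (hΨ z hz t ht).1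
    have h2 := hasDerivAt_fderiv_localFlow hU hΨ hz ht (hF _ (hΨW z hz t ht)) v
    have h1' : HasDerivAt (fun t ↦ (Ψ (z, t)).2) (F (Ψ (z, t))).2 t :=
      (ContinuousLinearMap.snd ℝ V (V →L[ℝ] ℝ)).hasFDerivAt.comp_hasDerivAt t h1
    have h2' : HasDerivAt (fun t ↦ (D t).1) (fderiv ℝ F (Ψ (z, t)) (D t)).1 t :=
      (ContinuousLinearMap.fst ℝ V (V →L[ℝ] ℝ)).hasFDerivAt.comp_hasDerivAt t h2
    have h3 := (h1'.clm_apply h2').sub ((hasDerivAt_id t).mul_const (fderiv ℝ k z v))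
    refine h3.congr_deriv ?_
    rw [← hconst t ht, (hkd _ (hΨW z hz t ht) (D t)).2]
    simp [D]
    ring
  have hd : DifferentiableOn ℝ (fun t ↦ (Ψ (z, t)).2 (D t).1 - t * fderiv ℝ k z v) (Ioo (-δ) δ) :=
    fun t ht ↦ (hder t ht).differentiableAt.differentiableWithinAt
  have hc := isOpen_Ioo.is_const_of_deriv_eq_zero isPreconnected_Ioo hd
    (fun t ht ↦ (hder t ht).deriv) ht hδ
  have hD0 : D 0 = v := by
    rw [← hslice 0 hδ]
    have : (fun z ↦ Ψ (z, 0)) =ᶠ[𝓝 z] id := by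
      filter_upwards [hU.mem_nhds hz] with y hy using hΨ0 y hy
    rw [this.fderiv_eq, fderiv_id]
    rfl
  simp only [hD0, hΨ0 z hz] at hc
  rw [hslice t ht]
  linarith

end Variational

section HamiltonianFlow

variable {n : ℕ} {M : Type*} [TopologicalSpace M] [ChartedSpace (EuclideanSpace ℝ (Fin n)) M]
  [IsManifold (𝓡 n) ∞ M]

/-- The differential of a real-valued function, as a real-valued linear form. -/
noncomputable def differential (k : Cotangent n M → ℝ) (p : Cotangent n M) :
    TangentSpace (cotangentModel n) p →L[ℝ] ℝ := mfderiv (cotangentModel n) 𝓘(ℝ, ℝ) k p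

/-- The time-`t` map `φ` pulls the canonical one-form `α` back to `α + t dk`, at the point `p`. -/
def ShiftsOneFormAt (m : ℕ∞ω) (k : Cotangent n M → ℝ) (φ : ℝ → Cotangent n M → Cotangent n M)
    (t : ℝ) (p : Cotangent n M) : Prop :=
  ContMDiffAt (cotangentModel n) (cotangentModel n) m (φ t) p ∧
    ∀ v : TangentSpace (cotangentModel n) p,
      canonicalOneForm (φ t p) (mfderiv (cotangentModel n) (cotangentModel n) (φ t) p v)
        = canonicalOneForm p v + t * differential k p v

lemma ShiftsOneFormAt.add {m : ℕ∞ω} (hm : m ≠ 0) {k : Cotangent n M → ℝ}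
    (hk : MDifferentiable (cotangentModel n) 𝓘(ℝ, ℝ) k)
    {φ : ℝ → Cotangent n M → Cotangent n M} {s t : ℝ} {p : Cotangent n M}
    (hadd : ∀ p, φ (s + t) p = φ t (φ s p)) (hkφ : ∀ p, k (φ s p) = k p)
    (hs : ShiftsOneFormAt m k φ s p) (ht : ShiftsOneFormAt m k φ t (φ s p)) :
    ShiftsOneFormAt m k φ (s + t) p := by
  have hfun : φ (s + t) = φ t ∘ φ s := funext hadd
  unfold ShiftsOneFormAt
  rw [hfun]
  refine ⟨ht.1.comp p hs.1, fun v ↦ ?_⟩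
  have hsd := hs.1.mdifferentiableAt hm
  have htd := ht.1.mdifferentiableAt hm
  rw [mfderiv_comp p htd hsd]
  refine (ht.2 (mfderiv (cotangentModel n) (cotangentModel n) (φ s) p v)).trans ?_
  rw [hs.2 v]
  have h1 : differential k p v = differential k (φ s p)
      (mfderiv (cotangentModel n) (cotangentModel n) (φ s) p v) := by
    have h2 : k = k ∘ φ s := funext fun p ↦ (hkφ p).symm
    unfold differential
    conv_lhs => rw [h2]
    rw [mfderiv_comp p (hk _) hsd]
    rfl
  rw [← h1]
  ring

variable [T2Space M]

lemma exists_nhds_shiftsOneFormAt {H k : Cotangent n M → ℝ}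
    (hH : ContMDiff (cotangentModel n) 𝓘(ℝ, ℝ) ∞ H)
    (hk : ContMDiff (cotangentModel n) 𝓘(ℝ, ℝ) ∞ k)
    (hkH : ∀ p, k p = canonicalOneForm p (hamiltonianVectorField H p) - H p)
    {φ : ℝ → Cotangent n M → Cotangent n M} (hφ : IsFlowOf (hamiltonianVectorField H) φ)
    (hkφ : ∀ t p, k (φ t p) = k p) {m : ℕ} (hm : 2 ≤ m) (p₀ : Cotangent n M) :
    ∃ U ∈ 𝓝 p₀, ∃ δ > 0, ∀ q ∈ U, ∀ t ∈ Ioo (-δ) δ, ShiftsOneFormAt m k φ t q := by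
  have hX := isSmoothField_hamiltonianVectorField hH
  let e := extChartAt (cotangentModel n) p₀
  obtain ⟨Ψ, U, hU, hp₀, hUt, δ, hδ, hΨ⟩ := hX.exists_localFlow p₀ (m := m) (by omega)
  have htgt : IsOpen e.target := isOpen_extChartAt_target p₀
  have hsrc : IsOpen (e.source ∩ e ⁻¹' U) :=
    (continuousOn_extChartAt p₀).isOpen_inter_preimage (isOpen_extChartAt_source p₀) hU
  refine ⟨e.source ∩ e ⁻¹' U, hsrc.mem_nhds ⟨mem_extChartAt_source p₀, hp₀⟩, δ, hδ,
    fun q hq t ht ↦ ?_⟩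
  have hflow : ∀ q ∈ e.source ∩ e ⁻¹' U, ∀ t ∈ Ioo (-δ) δ, φ t q = e.symm (Ψ (e q, t)) := by
    intro q hq t ht
    have h1 := hX.flow_eq_localFlow (fun p ↦ (hφ p).1) (fun p ↦ (hφ p).2) (p₀ := p₀)
      (c := fun t ↦ Ψ (e q, t)) (fun t ht ↦ ((hΨ _ hq.2).2 t ht).1)
      (fun t ht ↦ ((hΨ _ hq.2).2 t ht).2.1) ht
    rw [(hΨ _ hq.2).1] at h1
    rwa [e.left_inv hq.1] at h1
  have hev : φ t =ᶠ[𝓝 q] fun q ↦ e.symm (Ψ (e q, t)) := by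
    filter_upwards [hsrc.mem_nhds hq] with q' hq' using hflow q' hq' t ht
  have hΨt := (hΨ _ hq.2).2 t ht
  have hΨc : ContDiffAt ℝ m (fun z ↦ Ψ (z, t)) (e q) :=
    hΨt.2.2.comp (e q) (contDiffAt_id.prodMk contDiffAt_const)
  have heq : ContMDiffAt (cotangentModel n) 𝓘(ℝ, PhaseSpace n) m e q :=
    contMDiffAt_extChartAt' (by rw [← extChartAt_source (cotangentModel n)]; exact hq.1)
  have hsm : ContMDiffAt (cotangentModel n) (cotangentModel n) m (φ t) q := by
    refine ContMDiffAt.congr_of_eventuallyEq ?_ hev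
    have h1 : ContMDiffAt 𝓘(ℝ, PhaseSpace n) (cotangentModel n) m e.symm (Ψ (e q, t)) :=
      (contMDiffOn_extChartAt_symm p₀).contMDiffAt (htgt.mem_nhds hΨt.1)
    exact h1.comp q ((hΨc.contMDiffAt).comp q heq)
  refine ⟨hsm, fun v ↦ ?_⟩
  have hm' : (m : ℕ∞ω) ≠ 0 := by
    have : m ≠ 0 := by omega
    exact_mod_cast this
  have hφq : φ t q ∈ e.source := by
    rw [hflow q hq t ht]
    exact e.map_target hΨt.1
  have hed : MDifferentiableAt (cotangentModel n) 𝓘(ℝ, PhaseSpace n) e q :=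
    heq.mdifferentiableAt hm'
  obtain ⟨v', hv'⟩ : ∃ v' : PhaseSpace n,
    v' = mfderiv (cotangentModel n) 𝓘(ℝ, PhaseSpace n) e q v := ⟨_, rfl⟩
  have h1 : fderiv ℝ (fun z ↦ Ψ (z, t)) (e q) v' = mfderiv (cotangentModel n) 𝓘(ℝ, PhaseSpace n) e
      (φ t q) (mfderiv (cotangentModel n) (cotangentModel n) (φ t) q v) := by
    have hed' : MDifferentiableAt (cotangentModel n) 𝓘(ℝ, PhaseSpace n) e (φ t q) :=
      mdifferentiableAt_extChartAt (by rw [← extChartAt_source (cotangentModel n)]; exact hφq)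
    have h2 := mfderiv_comp q hed' (hsm.mdifferentiableAt hm')
    have h3 : e ∘ φ t =ᶠ[𝓝 q] (fun z ↦ Ψ (z, t)) ∘ e := by
      filter_upwards [hsrc.mem_nhds hq] with q' hq'
      simp only [Function.comp_apply]
      rw [hflow q' hq' t ht, e.right_inv ((hΨ _ hq'.2).2 t ht).1]
    have h4 := mfderiv_comp q ((hΨc.differentiableAt hm').mdifferentiableAt) hed
    rw [h3.mfderiv_eq, h4, mfderiv_eq_fderiv] at h2
    rw [hv']
    exact DFunLike.congr_fun h2 v
  have h2 : fderiv ℝ (k ∘ e.symm) (e q) v' = differential k q v := by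
    unfold differential
    have h3 : k =ᶠ[𝓝 q] (k ∘ e.symm) ∘ e := by
      filter_upwards [hsrc.mem_nhds hq] with q' hq'
      simp only [Function.comp_apply]
      rw [e.left_inv hq'.1]
    have h4 : DifferentiableAt ℝ (k ∘ e.symm) (e q) :=
      ((contDiffOn_comp_extChartAt_symm hk p₀).contDiffAt (htgt.mem_nhds (e.map_source hq.1))).differentiableAt
        (by simp)
    have h5 := mfderiv_comp q h4.mdifferentiableAt hed
    rw [h3.mfderiv_eq, h5, mfderiv_eq_fderiv, hv']
    rfl
  have h2m : ((2 : ℕ) : ℕ∞ω) ≤ m := by exact_mod_cast hm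
  have key := localFlow_pullback_oneForm (Ψ := Ψ) (F := chartField (I := cotangentModel n) (hamiltonianVectorField H) p₀)
    (H := H ∘ e.symm) (k := k ∘ e.symm) hU htgt (fun z hz ↦ (hΨ z hz).1)
    (fun z hz t ht ↦ ⟨((hΨ z hz).2 t ht).2.1, ((hΨ z hz).2 t ht).2.2.of_le h2m⟩)
    (fun z hz t ht ↦ ((hΨ z hz).2 t ht).1)
    (fun w hw ↦ ((hX p₀).contDiffAt (htgt.mem_nhds hw)).differentiableAt (by simp))
    (fun w hw ↦ ((contDiffOn_comp_extChartAt_symm hH p₀).contDiffAt (htgt.mem_nhds hw)).differentiableAt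
      (by simp))
    (fun w hw u ↦ stdTwoForm_chartField_hamiltonianVectorField hw (hH.mdifferentiable (by simp) _) u)
    (fun w hw ↦ by
      simp only [Function.comp_apply]
      rw [hkH, canonicalOneForm_eq_chart (e.map_target hw) _ _ rfl,
        mfderiv_extChartAt_eq_tangentCoordChange (e.map_target hw), e.right_inv hw]
      rfl)
    (fun z hz t ht ↦ by
      have h3 : e.symm z ∈ e.source ∩ e ⁻¹' U :=
        ⟨e.map_target (hUt hz), by rw [mem_preimage, e.right_inv (hUt hz)]; exact hz⟩
      have h4 := hflow _ h3 t ht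
      rw [e.right_inv (hUt hz)] at h4
      simp only [Function.comp_apply]
      rw [← h4, hkφ])
    hq.2 ht v'
  rw [h2] at key
  rw [canonicalOneForm_eq_chart hφq _ _ h1, canonicalOneForm_eq_chart hq.1 _ _ hv', ← key,
    hflow q hq t ht, e.right_inv hΨt.1]

/-- The flow of a smooth Hamiltonian vector field `X_H` is smooth and pulls the canonical one-form
`α` back to `α + t d(α(X_H) - H)`, provided that `α(X_H) - H` is constant along the flow. -/
theorem hamiltonianFlow_shiftsOneForm {H k : Cotangent n M → ℝ}
    (hH : ContMDiff (cotangentModel n) 𝓘(ℝ, ℝ) ∞ H)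
    (hk : ContMDiff (cotangentModel n) 𝓘(ℝ, ℝ) ∞ k)
    (hkH : ∀ p, k p = canonicalOneForm p (hamiltonianVectorField H p) - H p)
    {φ : ℝ → Cotangent n M → Cotangent n M} (hφ : IsFlowOf (hamiltonianVectorField H) φ)
    (hkφ : ∀ t p, k (φ t p) = k p) (t : ℝ) (p : Cotangent n M) :
    ShiftsOneFormAt ∞ k φ t p := by
  have key : ∀ m : ℕ, 2 ≤ m → ShiftsOneFormAt m k φ t p := fun m hm ↦ by
    have hadd := (isSmoothField_hamiltonianVectorField hH).flow_add (fun p ↦ (hφ p).1)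
      (fun p ↦ (hφ p).2)
    have hm' : (m : ℕ∞ω) ≠ 0 := by
      have : m ≠ 0 := by omega
      exact_mod_cast this
    exact flow_induction hadd (fun p ↦ (hφ p).2.continuous) (ShiftsOneFormAt m k φ)
      (fun s t p ↦ ShiftsOneFormAt.add hm' (hk.mdifferentiable (by simp)) (hadd s t) (hkφ s))
      (exists_nhds_shiftsOneFormAt hH hk hkH hφ hkφ hm) (fun p ↦ (hφ p).1) t p
  refine ⟨contMDiffAt_infty.2 fun m ↦ ?_, (key 2 le_rfl).2⟩
  exact (key (m + 2) (by omega)).1.of_le (by exact_mod_cast Nat.le_add_right m 2)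

end HamiltonianFlow

section Gram

/-- The dual norm of a scalar product, in terms of its Gram form in a parametrization. -/
lemma exists_equiv_norm_sq_eq_gram {V X : Type*} [NormedAddCommGroup V] [NormedSpace ℝ V] [FiniteDimensional ℝ V]
    [NormedAddCommGroup X] [InnerProductSpace ℝ X] (S : V ≃L[ℝ] X) (G : V →L[ℝ] V →L[ℝ] ℝ)
    (hG : ∀ u w, G u w = inner ℝ (S u) (S w)) :
    ∃ e : V ≃L[ℝ] (V →L[ℝ] ℝ), (e : V →L[ℝ] V →L[ℝ] ℝ) = G ∧
    ∀ ℓ : X →L[ℝ] ℝ, ‖ℓ‖ ^ 2 = ℓ (S (e.symm (ℓ.comp (S : V →L[ℝ] X)))) := by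
  have : FiniteDimensional ℝ X := LinearEquiv.finiteDimensional S.toLinearEquiv
  have : CompleteSpace X := FiniteDimensional.complete ℝ X
  have hsurj : ∀ ℓ : X →L[ℝ] ℝ, G (S.symm ((InnerProductSpace.toDual ℝ X).symm ℓ)) = ℓ.comp (S : V →L[ℝ] X) := by
    intro ℓ
    ext w
    simp [hG, InnerProductSpace.toDual_symm_apply]
  have hinj : Function.Injective G := by
    refine (injective_iff_map_eq_zero G).2 fun u hu ↦ ?_
    have h1 := hG u u
    rw [hu, zero_apply] at h1
    exact S.map_eq_zero_iff.1 (inner_self_eq_zero.1 h1.symm)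
  let e' : V ≃ₗ[ℝ] (V →L[ℝ] ℝ) := LinearEquiv.ofBijective G.toLinearMap ⟨hinj, fun η ↦ by
    refine ⟨_, (hsurj (η.comp (S.symm : X →L[ℝ] V))).trans ?_⟩
    ext; simp⟩
  refine ⟨e'.toContinuousLinearEquiv, by ext; rfl, fun ℓ ↦ ?_⟩
  have h2 : e'.toContinuousLinearEquiv.symm (ℓ.comp (S : V →L[ℝ] X))
      = S.symm ((InnerProductSpace.toDual ℝ X).symm ℓ) := by
    rw [ContinuousLinearEquiv.symm_apply_eq]
    exact (hsurj ℓ).symm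
  rw [h2, ContinuousLinearEquiv.apply_symm_apply, ← InnerProductSpace.toDual_symm_apply, real_inner_self_eq_norm_sq,
    LinearIsometryEquiv.norm_map]

variable
  {EB : Type*} [NormedAddCommGroup EB] [NormedSpace ℝ EB]
  {HB : Type*} [TopologicalSpace HB] {IB : ModelWithCorners ℝ EB HB}
  {B : Type*} [TopologicalSpace B] [ChartedSpace HB B]
  {F : Type*} [NormedAddCommGroup F] [NormedSpace ℝ F]
  {E : B → Type*} [TopologicalSpace (TotalSpace F E)] [∀ x, NormedAddCommGroup (E x)]
  [∀ x, InnerProductSpace ℝ (E x)]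
  [FiberBundle F E] [VectorBundle ℝ F E]

/-- The Gram form of a Riemannian metric in a trivialization. -/
noncomputable def gramForm (e : Trivialization F (π F E)) [MemTrivializationAtlas e] (b : B) :
    F →L[ℝ] F →L[ℝ] ℝ :=
  (innerSL ℝ (E := E b)).bilinearComp (e.symmL ℝ b) (e.symmL ℝ b)

lemma gramForm_apply (e : Trivialization F (π F E)) [MemTrivializationAtlas e] {b : B}
    (hb : b ∈ e.baseSet) (u w : F) :
    gramForm e b u w = inner ℝ (e.symm b u) (e.symm b w) := by
  simp [gramForm, e.symmL_apply hb]

lemma contMDiffOn_gramForm_apply [ContMDiffVectorBundle ∞ F E IB]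
    [IsContMDiffRiemannianBundle IB ∞ F E] (e : Trivialization F (π F E))
    [MemTrivializationAtlas e] (u w : F) :
    ContMDiffOn IB 𝓘(ℝ, ℝ) ∞ (fun b ↦ gramForm e b u w) e.baseSet := by
  have h : ∀ u : F, ContMDiffOn IB (IB.prod 𝓘(ℝ, F)) ∞
      (fun b ↦ (⟨b, e.symm b u⟩ : TotalSpace F E)) e.baseSet := by
    intro u
    have h1 : ContMDiffOn IB (IB.prod 𝓘(ℝ, F)) ∞ (fun b : B ↦ (b, u)) e.baseSet :=
      contMDiffOn_id.prodMk contMDiffOn_const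
    refine (e.contMDiffOn_symm.comp h1 fun b hb ↦ by simpa [e.mem_target] using hb).congr
      fun b hb ↦ e.mk_symm hb u
  exact ((h u).inner_bundle (h w)).congr fun b hb ↦ gramForm_apply e hb u w

lemma exists_equiv_gramForm [FiniteDimensional ℝ F] (e : Trivialization F (π F E))
    [MemTrivializationAtlas e] {b : B} (hb : b ∈ e.baseSet) :
    ∃ e' : F ≃L[ℝ] (F →L[ℝ] ℝ), (e' : F →L[ℝ] F →L[ℝ] ℝ) = gramForm e b ∧
    ∀ ℓ : E b →L[ℝ] ℝ, ‖ℓ‖ ^ 2 = (ℓ.comp (e.symmL ℝ b)) (e'.symm (ℓ.comp (e.symmL ℝ b))) := by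
  have h0 : ∀ u, (e.continuousLinearEquivAt ℝ b hb).symm u = e.symmL ℝ b u := fun u ↦ by
    rw [e.symmL_apply hb]
    rfl
  have h1 : ((e.continuousLinearEquivAt ℝ b hb).symm : F →L[ℝ] E b) = e.symmL ℝ b := by
    ext u
    exact h0 u
  obtain ⟨e', he', h⟩ := exists_equiv_norm_sq_eq_gram (e.continuousLinearEquivAt ℝ b hb).symm
    (gramForm e b) (fun u w ↦ by rw [gramForm_apply e hb, h0, h0, e.symmL_apply hb, e.symmL_apply hb])
  refine ⟨e', he', fun ℓ ↦ ?_⟩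
  rw [h ℓ, h1, ContinuousLinearMap.comp_apply, h0]

end Gram

section Conorm

variable {n : ℕ} {M : Type*} [TopologicalSpace M] [ChartedSpace (EuclideanSpace ℝ (Fin n)) M]
  [IsManifold (𝓡 n) ∞ M]

lemma covector_comp_symmL (p₀ : Cotangent n M) {z : PhaseSpace n}
    (hz : z ∈ (extChartAt (cotangentModel n) p₀).target) :
    (covector ((extChartAt (cotangentModel n) p₀).symm z)).comp
      ((trivializationAt (EuclideanSpace ℝ (Fin n)) (TangentSpace (𝓡 n)) p₀.proj).symmL ℝ
        ((extChartAt (cotangentModel n) p₀).symm z).proj) = z.2 := by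
  have hz' := hz
  rw [FiberBundle.extChartAt_target] at hz'
  have hq : ((extChartAt (cotangentModel n) p₀).symm z).proj ∈
      (chartAt (EuclideanSpace ℝ (Fin n)) p₀.proj).source := by
    rw [cotangent_extChartAt_symm_proj p₀ z hz, ← extChartAt_source (𝓡 n)]
    exact (extChartAt (𝓡 n) p₀.proj).map_target hz'.1.1
  rw [covector_extChartAt_symm p₀ z hz _ rfl, ← TangentBundle.continuousLinearMapAt_trivializationAt hq]
  ext u
  have := (trivializationAt (EuclideanSpace ℝ (Fin n)) (TangentSpace (𝓡 n)) p₀.proj).continuousLinearMapAt_symmL (R := ℝ) hq u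
  exact congrArg z.2 this

variable [RiemannianBundle (fun x : M ↦ TangentSpace (𝓡 n) x)]
  [IsContMDiffRiemannianBundle (𝓡 n) ∞ (EuclideanSpace ℝ (Fin n))
      (fun x : M ↦ TangentSpace (𝓡 n) x)]

/-- The square of the dual norm is smooth on `T*M`. -/
lemma contMDiff_conorm_sq :
    ContMDiff (cotangentModel n) 𝓘(ℝ, ℝ) ∞ (fun p : Cotangent n M ↦ conorm p ^ 2) := by
  intro p₀
  let e := extChartAt (cotangentModel n) p₀
  let e₀ := extChartAt (𝓡 n) p₀.proj
  let τ := trivializationAt (EuclideanSpace ℝ (Fin n)) (TangentSpace (𝓡 n)) p₀.proj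
  have hbase : ∀ y ∈ e₀.target, e₀.symm y ∈ τ.baseSet := fun y hy ↦ by
    have := e₀.map_target hy
    rwa [extChartAt_source] at this
  let G : EuclideanSpace ℝ (Fin n) → EuclideanSpace ℝ (Fin n) →L[ℝ] EuclideanSpace ℝ (Fin n) →L[ℝ] ℝ :=
    fun y ↦ gramForm (E := fun x : M ↦ TangentSpace (𝓡 n) x) τ (e₀.symm y)
  have hG : ContDiffOn ℝ ∞ G e₀.target := by
    rw [contDiffOn_clm_apply]
    intro u
    rw [contDiffOn_clm_apply]
    intro w
    refine contMDiffOn_iff_contDiffOn.1 ?_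
    exact (contMDiffOn_gramForm_apply (IB := 𝓡 n) (E := fun x : M ↦ TangentSpace (𝓡 n) x) τ u w).comp
      (contMDiffOn_extChartAt_symm p₀.proj) hbase
  have hGinv : ∀ y ∈ e₀.target, ContDiffAt ℝ ∞ (fun y ↦ (G y).inverse) y := by
    intro y hy
    obtain ⟨e', he', -⟩ := exists_equiv_gramForm (E := fun x : M ↦ TangentSpace (𝓡 n) x) τ (hbase y hy)
    refine ContDiffAt.comp y (g := ContinuousLinearMap.inverse) ?_
      (hG.contDiffAt ((isOpen_extChartAt_target p₀.proj).mem_nhds hy))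
    change ContDiffAt ℝ ∞ _ (gramForm (E := fun x : M ↦ TangentSpace (𝓡 n) x) τ (e₀.symm y))
    rw [← he']
    exact contDiffAt_map_inverse e'
  have hformula : ∀ z ∈ e.target, conorm (e.symm z) ^ 2 = z.2 ((G z.1).inverse z.2) := by
    intro z hz
    have hz' := hz
    rw [FiberBundle.extChartAt_target] at hz'
    have hproj := cotangent_extChartAt_symm_proj p₀ z hz
    have hb : (e.symm z).proj ∈ τ.baseSet := hproj ▸ hbase z.1 hz'.1.1
    obtain ⟨e', he', h⟩ := exists_equiv_gramForm (E := fun x : M ↦ TangentSpace (𝓡 n) x) τ hb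
    have h1 := h (covector (e.symm z))
    have h2 : (covector (e.symm z)).comp (τ.symmL ℝ (e.symm z).proj) = z.2 :=
      covector_comp_symmL p₀ hz
    have h3 : G z.1 = e' := by
      rw [he']
      change gramForm τ (e₀.symm z.1) = gramForm τ (e.symm z).proj
      rw [hproj]
    rw [h3, ContinuousLinearMap.inverse_equiv]
    refine Eq.trans h1 ?_
    exact congrArg (fun η : EuclideanSpace ℝ (Fin n) →L[ℝ] ℝ ↦ η (e'.symm η)) h2
  have hz₀ : e p₀ ∈ e.target := mem_extChartAt_target p₀
  have hz₀' := hz₀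
  rw [FiberBundle.extChartAt_target] at hz₀'
  have h1 : ContDiffAt ℝ ∞ (fun z : PhaseSpace n ↦ z.2 ((G z.1).inverse z.2)) (e p₀) := by
    have h2 : ContDiffAt ℝ ∞ (fun z : PhaseSpace n ↦ (G z.1).inverse) (e p₀) :=
      (hGinv _ hz₀'.1.1).comp (e p₀) contDiffAt_fst
    exact contDiffAt_snd.clm_apply (h2.clm_apply contDiffAt_snd)
  refine (h1.contMDiffAt.comp p₀ (contMDiffAt_extChartAt (I := cotangentModel n))).congr_of_eventuallyEq ?_
  filter_upwards [extChartAt_source_mem_nhds (I := cotangentModel n) p₀] with p hp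
  simp only [Function.comp_apply]
  rw [← hformula _ (e.map_source hp), e.left_inv hp]

end Conorm

section RadialFunctions

/-- A smooth function that vanishes on `(-∞, 1)` has a smooth composition with the square root. -/
lemma contDiff_comp_sqrt {a : ℝ → ℝ} (ha : ContDiff ℝ ∞ a) (ha0 : ∀ r < 1, a r = 0) :
    ContDiff ℝ ∞ (fun s ↦ a √s) := by
  rw [contDiff_iff_contDiffAt]
  intro s
  rcases lt_or_ge s 1 with hs | hs
  · refine (contDiffAt_const (c := (0 : ℝ))).congr_of_eventuallyEq ?_
    filter_upwards [Iio_mem_nhds hs] with s' hs'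
    exact ha0 _ (by rw [Real.sqrt_lt' one_pos]; simpa using hs')
  · exact ha.contDiffAt.comp s (Real.contDiffAt_sqrt (by positivity))

/-- The antiderivative, vanishing at `1`. -/
noncomputable def antiderivFromOne (β : ℝ → ℝ) (r : ℝ) : ℝ := ∫ s in (1 : ℝ)..r, β s

lemma hasDerivAt_antiderivFromOne {β : ℝ → ℝ} (hβ : Continuous β) (r : ℝ) :
    HasDerivAt (antiderivFromOne β) (β r) r :=
  intervalIntegral.integral_hasDerivAt_right (hβ.intervalIntegrable _ _)
    (hβ.stronglyMeasurableAtFilter _ _) hβ.continuousAt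

lemma contDiff_antiderivFromOne {β : ℝ → ℝ} (hβ : ContDiff ℝ ∞ β) :
    ContDiff ℝ ∞ (antiderivFromOne β) := by
  have h := hasDerivAt_antiderivFromOne hβ.continuous
  rw [contDiff_infty_iff_deriv]
  exact ⟨fun r ↦ (h r).differentiableAt, by rwa [funext fun r ↦ (h r).deriv]⟩

lemma eq_zero_of_le_one {β : ℝ → ℝ} (hβ : Continuous β) (hβ0 : ∀ r < 1, β r = 0) {r : ℝ}
    (hr : r ≤ 1) : β r = 0 := by
  have h : closure (Iio (1 : ℝ)) ⊆ {r | β r = 0} :=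
    (isClosed_eq hβ continuous_const).closure_subset_iff.2 hβ0
  rw [closure_Iio] at h
  exact h hr

lemma antiderivFromOne_eq_zero {β : ℝ → ℝ} (hβ : Continuous β) (hβ0 : ∀ r < 1, β r = 0) {r : ℝ}
    (hr : r ≤ 1) : antiderivFromOne β r = 0 := by
  refine (intervalIntegral.integral_congr (g := fun _ ↦ 0) fun s hs ↦ ?_).trans (by simp)
  rw [uIcc_of_ge hr] at hs
  exact eq_zero_of_le_one hβ hβ0 hs.2

lemma tendsto_antiderivFromOne {β : ℝ → ℝ} (hβ : Continuous β) {r₀ : ℝ} (hr₀ : 0 < r₀)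
    (hβ_end : ∀ r, r₀ ≤ r → β r = 1 / r) : Tendsto (antiderivFromOne β) atTop atTop := by
  have h : ∀ r, r₀ ≤ r → antiderivFromOne β r = (antiderivFromOne β r₀ - Real.log r₀) + Real.log r := by
    intro r hr
    have h1 : antiderivFromOne β r = antiderivFromOne β r₀ + ∫ s in r₀..r, β s :=
      (intervalIntegral.integral_add_adjacent_intervals (hβ.intervalIntegrable _ _)
        (hβ.intervalIntegrable _ _)).symm
    have h2 : ∫ s in r₀..r, β s = ∫ s in r₀..r, 1 / s :=
      intervalIntegral.integral_congr fun s hs ↦ hβ_end s (by rw [uIcc_of_le hr] at hs; exact hs.1)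
    rw [h1, h2, integral_one_div_of_pos hr₀ (hr₀.trans_le hr), Real.log_div (by linarith) hr₀.ne']
    ring
  refine (tendsto_atTop_add_const_left _ (antiderivFromOne β r₀ - Real.log r₀)
    Real.tendsto_log_atTop).congr' ?_
  filter_upwards [eventually_ge_atTop r₀] with r hr using (h r hr).symm

end RadialFunctions

section Scaling

variable {n : ℕ} {M : Type*} [TopologicalSpace M] [ChartedSpace (EuclideanSpace ℝ (Fin n)) M]

lemma fiberScale_one (p : Cotangent n M) : fiberScale 1 p = p := by
  simp [fiberScale]

variable [IsManifold (𝓡 n) ∞ M]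

lemma fiberScale_mem_source {p₀ p : Cotangent n M} (s : ℝ)
    (hp : p ∈ (extChartAt (cotangentModel n) p₀).source) :
    fiberScale s p ∈ (extChartAt (cotangentModel n) p₀).source := by
  rw [FiberBundle.extChartAt, PartialEquiv.trans_source] at hp ⊢
  refine ⟨(Trivialization.mem_source _).2 ((Trivialization.mem_source _).1 hp.1 :), ?_⟩
  have h := hp.2
  simp only [mem_preimage, PartialEquiv.prod_source, mem_prod] at h ⊢
  exact ⟨h.1, mem_univ _⟩

lemma extChartAt_fiberScale (p₀ p : Cotangent n M) (s : ℝ) :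
    extChartAt (cotangentModel n) p₀ (fiberScale s p)
      = ((extChartAt (cotangentModel n) p₀ p).1, s • (extChartAt (cotangentModel n) p₀ p).2) := by
  have h : ∀ q : Cotangent n M, extChartAt (cotangentModel n) p₀ q
      = (extChartAt (𝓡 n) p₀.proj q.proj, ContinuousLinearMap.inCoordinates (EuclideanSpace ℝ (Fin n)) (TangentSpace (𝓡 n)) ℝ (Bundle.Trivial M ℝ) p₀.proj q.proj p₀.proj q.proj q.snd) := by
    intro q
    rw [FiberBundle.extChartAt]
    rfl
  rw [h, h]
  refine Prod.ext rfl ?_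
  ext u
  simp [ContinuousLinearMap.inCoordinates, fiberScale]

lemma fiberScale_eq_symm (p : Cotangent n M) (s : ℝ) :
    fiberScale s p = (extChartAt (cotangentModel n) p).symm
      ((extChartAt (cotangentModel n) p p).1, s • (extChartAt (cotangentModel n) p p).2) := by
  rw [← extChartAt_fiberScale,
    (extChartAt (cotangentModel n) p).left_inv (fiberScale_mem_source s (mem_extChartAt_source p))]

lemma contMDiff_fiberScale (p : Cotangent n M) :
    ContMDiff 𝓘(ℝ, ℝ) (cotangentModel n) ∞ (fun s ↦ fiberScale s p) := by
  have h : ContMDiff 𝓘(ℝ, ℝ) 𝓘(ℝ, PhaseSpace n) ∞ (fun s : ℝ ↦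
      (((extChartAt (cotangentModel n) p p).1, s • (extChartAt (cotangentModel n) p p).2) : PhaseSpace n)) :=
    (contDiff_const.prodMk (contDiff_id.smul contDiff_const)).contMDiff
  simp only [fiberScale_eq_symm]
  refine (contMDiffOn_extChartAt_symm (I := cotangentModel n) (n := ∞) p).comp_contMDiff h fun s ↦ ?_
  rw [← extChartAt_fiberScale]
  exact (extChartAt (cotangentModel n) p).map_source (fiberScale_mem_source s (mem_extChartAt_source p))

/-- `(r, p) ↦ r p` is continuous. -/
lemma continuous_fiberScale : Continuous (fun x : ℝ × Cotangent n M ↦ fiberScale x.1 x.2) := by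
  rw [continuous_iff_continuousAt]
  rintro ⟨s, p⟩
  let e := extChartAt (cotangentModel n) p
  have hs : fiberScale s p ∈ e.source := fiberScale_mem_source s (mem_extChartAt_source p)
  have h1 : ContinuousAt (fun x : ℝ × Cotangent n M ↦ e x.2) (s, p) :=
    (continuousAt_extChartAt p).comp (f := Prod.snd) (x := (s, p)) continuousAt_snd
  have h2 : ContinuousAt (fun x : ℝ × Cotangent n M ↦ e.symm ((e x.2).1, x.1 • (e x.2).2)) (s, p) := by
    refine ContinuousAt.comp (g := e.symm) ?_
      ((continuousAt_fst.comp h1).prodMk (continuousAt_fst.smul (continuousAt_snd.comp h1)))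
    have := continuousAt_extChartAt_symm' (I := cotangentModel n) hs
    rwa [extChartAt_fiberScale] at this
  refine h2.congr ?_
  filter_upwards [continuousAt_snd.preimage_mem_nhds (extChartAt_source_mem_nhds (I := cotangentModel n) p)]
    with x hx
  rw [← extChartAt_fiberScale, e.left_inv (fiberScale_mem_source _ hx)]

/-- `α(X_H)` is the radial derivative of `H`. -/
lemma canonicalOneForm_hamiltonianVectorField {H : Cotangent n M → ℝ} {p : Cotangent n M}
    (hH : MDifferentiableAt (cotangentModel n) 𝓘(ℝ, ℝ) H p) :
    canonicalOneForm p (hamiltonianVectorField H p) = deriv (fun s ↦ H (fiberScale s p)) 1 := by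
  let e := extChartAt (cotangentModel n) p
  let z : PhaseSpace n := e p
  have hz : z ∈ e.target := mem_extChartAt_target p
  have hzp : e.symm z = p := e.left_inv (mem_extChartAt_source p)
  have key : ∀ q, q = e.symm z → canonicalOneForm q (hamiltonianVectorField H q)
      = fderiv ℝ (H ∘ e.symm) z (0, z.2) := by
    rintro q rfl
    have h1 := stdTwoForm_chartField_hamiltonianVectorField hz (by rwa [← hzp] at hH) (0, z.2)
    have hq : e.symm z ∈ e.source := e.map_target hz
    rw [canonicalOneForm_eq_chart hq _ (chartField (I := cotangentModel n) (hamiltonianVectorField H) p z)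
      (by rw [mfderiv_extChartAt_eq_tangentCoordChange hq]; rfl)]
    rw [show e (e.symm z) = z from e.right_inv hz]
    simp only [stdTwoForm, map_zero, zero_sub, neg_inj] at h1
    exact h1
  rw [key p hzp.symm]
  have hd : DifferentiableAt ℝ (H ∘ e.symm) z := by
    refine MDifferentiableAt.differentiableAt ?_
    exact MDifferentiableAt.comp (I' := cotangentModel n) z (by rwa [← hzp] at hH) (mdifferentiableAt_extChartAt_symm hz)
  have hc : HasDerivAt (fun s : ℝ ↦ ((z.1, s • z.2) : PhaseSpace n)) (0, z.2) 1 := by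
    have := (hasDerivAt_const (1 : ℝ) z.1).prodMk ((hasDerivAt_id (1 : ℝ)).smul_const z.2)
    simpa using this
  have h2 : HasDerivAt ((H ∘ e.symm) ∘ (fun s : ℝ ↦ ((z.1, s • z.2) : PhaseSpace n)))
      (fderiv ℝ (H ∘ e.symm) z (0, z.2)) 1 := by
    refine HasFDerivAt.comp_hasDerivAt (1 : ℝ) ?_ hc
    simpa using hd.hasFDerivAt
  rw [← h2.deriv]
  congr 1
  funext s
  simp only [Function.comp_apply]
  rw [fiberScale_eq_symm]

end Scaling

section HamiltonianFunctions

variable {n : ℕ} {M : Type*} [TopologicalSpace M] [ChartedSpace (EuclideanSpace ℝ (Fin n)) M]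
  [IsManifold (𝓡 n) ∞ M]

lemma canonicalTwoForm_smul_left (c : ℝ) (p : Cotangent n M)
    (v w : TangentSpace (cotangentModel n) p) :
    canonicalTwoForm p (c • v) w = c * canonicalTwoForm p v w := by
  rw [canonicalTwoForm_apply, canonicalTwoForm_apply, mul_sub]
  refine congrArg₂ (· - ·) rfl ?_
  exact map_smul (show EuclideanSpace ℝ (Fin n) →L[ℝ] ℝ from w.2) c v.1

lemma hamiltonianVectorField_eq_smul {H K : Cotangent n M → ℝ} {p : Cotangent n M} {c : ℝ}
    (h : differential H p = c • differential K p) :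
    hamiltonianVectorField H p = c • hamiltonianVectorField K p := by
  refine (existsUnique_canonicalTwoForm p (differential H p)).unique
    (canonicalTwoForm_hamiltonianVectorField H p) fun w ↦ ?_
  have h1 : canonicalTwoForm p (hamiltonianVectorField K p) w = - differential K p w :=
    canonicalTwoForm_hamiltonianVectorField K p w
  rw [canonicalTwoForm_smul_left, h1, h]
  simp

lemma differential_comp {g : ℝ → ℝ} {H : Cotangent n M → ℝ} {p : Cotangent n M} {c : ℝ}
    (hg : HasDerivAt g c (H p)) (hH : MDifferentiableAt (cotangentModel n) 𝓘(ℝ, ℝ) H p) :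
    differential (fun p ↦ g (H p)) p = c • differential H p := by
  have h := mfderiv_comp p (I' := 𝓘(ℝ, ℝ)) hg.differentiableAt.mdifferentiableAt hH
  refine Eq.trans h ?_
  refine ContinuousLinearMap.ext fun w ↦ ?_
  have h1 : mfderiv 𝓘(ℝ, ℝ) 𝓘(ℝ, ℝ) g (H p) (differential H p w) = fderiv ℝ g (H p) (differential H p w) := by
    rw [mfderiv_eq_fderiv]
    rfl
  have h2 : ∀ r : ℝ, fderiv ℝ g (H p) r = c * r := fun r ↦ by
    rw [hg.hasFDerivAt.fderiv]
    simp [mul_comm]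
  exact h1.trans (h2 _)

/-- `dH(X_{g ∘ H}) = 0`. -/
lemma differential_hamiltonianVectorField_comp {g : ℝ → ℝ} {H : Cotangent n M → ℝ}
    {p : Cotangent n M} {c : ℝ} (hg : HasDerivAt g c (H p))
    (hH : MDifferentiableAt (cotangentModel n) 𝓘(ℝ, ℝ) H p) :
    differential H p (hamiltonianVectorField (fun p ↦ g (H p)) p) = 0 := by
  refine (congrArg (differential H p)
    (hamiltonianVectorField_eq_smul (differential_comp hg hH))).trans ?_
  refine ((differential H p).map_smul c _).trans ?_
  have h1 : canonicalTwoForm p (hamiltonianVectorField H p) (hamiltonianVectorField H p)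
      = - differential H p (hamiltonianVectorField H p) :=
    canonicalTwoForm_hamiltonianVectorField H p _
  have h2 : canonicalTwoForm p (hamiltonianVectorField H p) (hamiltonianVectorField H p) = 0 := by
    rw [canonicalTwoForm_apply, sub_self]
  rw [show differential H p (hamiltonianVectorField H p) = 0 by linarith, smul_zero]

/-- A function is constant along the integral curves of the vector fields in the kernel of its
differential. -/
lemma eq_of_isMIntegralCurve {H : Cotangent n M → ℝ} (hH : MDifferentiable (cotangentModel n) 𝓘(ℝ, ℝ) H)
    {X : (p : Cotangent n M) → TangentSpace (cotangentModel n) p}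
    (hX : ∀ p, differential H p (X p) = 0) {γ : ℝ → Cotangent n M} (hγ : IsMIntegralCurve γ X)
    (t s : ℝ) : H (γ t) = H (γ s) := by
  have h : ∀ t, HasDerivAt (H ∘ γ) 0 t := fun t ↦ by
    obtain ⟨l, hl⟩ : ∃ l : ℝ →L[ℝ] ℝ, l = (differential H (γ t)).comp
      ((1 : ℝ →L[ℝ] ℝ).smulRight (X (γ t))) := ⟨_, rfl⟩
    have h1 : HasMFDerivAt 𝓘(ℝ, ℝ) 𝓘(ℝ, ℝ) (H ∘ γ) t l :=
      hl ▸ (hH (γ t)).hasMFDerivAt.comp t (hγ t)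
    have h2 : HasFDerivAt (H ∘ γ) l t := h1.hasFDerivAt
    refine h2.hasDerivAt.congr_deriv ?_
    rw [hl]
    refine Eq.trans ?_ (hX (γ t))
    exact congrArg (differential H (γ t)) (one_smul ℝ (X (γ t)))
  exact is_const_of_deriv_eq_zero (fun t ↦ (h t).differentiableAt) (fun t ↦ (h t).deriv) t s

end HamiltonianFunctions

section Radial

variable {n : ℕ} {M : Type*} [TopologicalSpace M] [ChartedSpace (EuclideanSpace ℝ (Fin n)) M]
  [RiemannianBundle (fun x : M ↦ TangentSpace (𝓡 n) x)]

lemma norm_smul_dual {V : Type*} [NormedAddCommGroup V] [NormedSpace ℝ V] (r : ℝ) (l : V →L[ℝ] ℝ) :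
    ‖r • l‖ = |r| * ‖l‖ := norm_smul r l

lemma conorm_nonneg (p : Cotangent n M) : 0 ≤ conorm p :=
  (covector p).opNorm_nonneg

lemma conorm_fiberScale (r : ℝ) (p : Cotangent n M) : conorm (fiberScale r p) = |r| * conorm p :=
  norm_smul_dual r (covector p)

lemma sqrt_conorm_sq (p : Cotangent n M) : √(conorm p ^ 2) = conorm p :=
  Real.sqrt_sq (conorm_nonneg p)

variable [IsManifold (𝓡 n) ∞ M] [IsContMDiffRiemannianBundle (𝓡 n) ∞ (EuclideanSpace ℝ (Fin n))
      (fun x : M ↦ TangentSpace (𝓡 n) x)]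

lemma continuous_conorm : Continuous (conorm : Cotangent n M → ℝ) := by
  have h := (contMDiff_conorm_sq (n := n) (M := M)).continuous.sqrt
  simpa only [sqrt_conorm_sq] using h

lemma contMDiff_comp_conorm {a : ℝ → ℝ} (ha : ContDiff ℝ ∞ a) (ha0 : ∀ r < 1, a r = 0) :
    ContMDiff (cotangentModel n) 𝓘(ℝ, ℝ) ∞ (fun p : Cotangent n M ↦ a (conorm p)) := by
  have h := (contDiff_comp_sqrt ha ha0).contMDiff.comp (contMDiff_conorm_sq (n := n) (M := M))
  simpa only [Function.comp_def, sqrt_conorm_sq] using h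

lemma mdifferentiableAt_conorm {p : Cotangent n M} (hp : conorm p ≠ 0) :
    MDifferentiableAt (cotangentModel n) 𝓘(ℝ, ℝ) conorm p := by
  have h1 : DifferentiableAt ℝ Real.sqrt (conorm p ^ 2) :=
    (Real.hasDerivAt_sqrt (by positivity)).differentiableAt
  have h := h1.mdifferentiableAt.comp p (contMDiff_conorm_sq.mdifferentiable (by simp) p)
  simpa only [Function.comp_def, sqrt_conorm_sq] using h

variable {β : ℝ → ℝ}

/-- The Reeb perturbation is the Hamiltonian vector field of a radial function. -/
lemma reebPerturbation_eq (hβ : ContDiff ℝ ∞ β) (hβ0 : ∀ r < 1, β r = 0) :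
    (reebPerturbation β : (p : Cotangent n M) → TangentSpace (cotangentModel n) p)
      = hamiltonianVectorField (fun p ↦ antiderivFromOne β (conorm p)) := by
  funext p
  symm
  refine hamiltonianVectorField_eq_smul ?_
  rcases lt_or_ge (conorm p) 1 with hp | hp
  · have h : (fun p : Cotangent n M ↦ antiderivFromOne β (conorm p)) =ᶠ[𝓝 p] fun _ ↦ 0 := by
      filter_upwards [continuous_conorm.continuousAt.eventually_lt_const hp] with q hq
      exact antiderivFromOne_eq_zero hβ.continuous hβ0 hq.le
    rw [hβ0 _ hp, zero_smul]
    exact h.mfderiv_eq.trans mfderiv_const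
  · exact differential_comp (hasDerivAt_antiderivFromOne hβ.continuous _)
      (mdifferentiableAt_conorm (by linarith))

lemma contMDiff_antiderivFromOne_conorm (hβ : ContDiff ℝ ∞ β) (hβ0 : ∀ r < 1, β r = 0) :
    ContMDiff (cotangentModel n) 𝓘(ℝ, ℝ) ∞
      (fun p : Cotangent n M ↦ antiderivFromOne β (conorm p)) :=
  contMDiff_comp_conorm (contDiff_antiderivFromOne hβ)
    fun _ hr ↦ antiderivFromOne_eq_zero hβ.continuous hβ0 hr.le

/-- The dual norm is constant along the integral curves of the Reeb perturbation. -/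
lemma conorm_eq_of_isMIntegralCurve (hβ : ContDiff ℝ ∞ β) (hβ0 : ∀ r < 1, β r = 0)
    {γ : ℝ → Cotangent n M} (hγ : IsMIntegralCurve γ (reebPerturbation β)) (t s : ℝ) :
    conorm (γ t) = conorm (γ s) := by
  have hQ := (contMDiff_conorm_sq (n := n) (M := M)).mdifferentiable (by simp)
  have h : conorm (γ t) ^ 2 = conorm (γ s) ^ 2 := by
    refine eq_of_isMIntegralCurve hQ (fun p ↦ ?_) hγ t s
    have hb := contDiff_comp_sqrt (contDiff_antiderivFromOne hβ)
      fun _ hr ↦ antiderivFromOne_eq_zero hβ.continuous hβ0 hr.le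
    have h1 := differential_hamiltonianVectorField_comp (H := fun p : Cotangent n M ↦ conorm p ^ 2)
      (hb.differentiable (by simp) (conorm p ^ 2)).hasDerivAt (hQ p)
    simpa only [sqrt_conorm_sq, ← reebPerturbation_eq hβ hβ0] using h1
  rwa [sq_eq_sq₀ (conorm_nonneg _) (conorm_nonneg _)] at h

/-- `α(X) = β(|ξ|) |ξ|` for the Reeb perturbation `X`. -/
lemma canonicalOneForm_reebPerturbation (hβ : ContDiff ℝ ∞ β) (hβ0 : ∀ r < 1, β r = 0)
    (p : Cotangent n M) :
    canonicalOneForm p (reebPerturbation β p) = β (conorm p) * conorm p := by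
  rw [reebPerturbation_eq hβ hβ0, canonicalOneForm_hamiltonianVectorField
    ((contMDiff_antiderivFromOne_conorm hβ hβ0).mdifferentiable (by simp) p)]
  simp only [conorm_fiberScale]
  have h1 : HasDerivAt (fun s : ℝ ↦ |s| * conorm p) (conorm p) 1 := by
    have h2 : HasDerivAt (fun s : ℝ ↦ s * conorm p) (conorm p) 1 := by
      simpa using (hasDerivAt_id (1 : ℝ)).mul_const (conorm p)
    refine h2.congr_of_eventuallyEq ?_
    filter_upwards [lt_mem_nhds (zero_lt_one (α := ℝ))] with s hs
    rw [abs_of_pos hs]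
  have h3 := HasDerivAt.comp (1 : ℝ) (hasDerivAt_antiderivFromOne hβ.continuous _) h1
  rw [abs_one, one_mul] at h3
  exact h3.deriv

/-- The closed codisc bundles of a compact manifold are compact. -/
lemma isCompact_setOf_conorm_le [CompactSpace M] [T2Space M] (R : ℝ) :
    IsCompact {p : Cotangent n M | conorm p ≤ R} := by
  have : IsContinuousRiemannianBundle (EuclideanSpace ℝ (Fin n)) (fun x : M ↦ TangentSpace (𝓡 n) x) := by
    obtain ⟨g, hg, h⟩ := IsContMDiffRiemannianBundle.exists_contMDiff (IB := 𝓡 n) (n := ∞)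
      (F := EuclideanSpace ℝ (Fin n)) (E := fun x : M ↦ TangentSpace (𝓡 n) x)
    exact ⟨g, hg.continuous, h⟩
  have hloc : ∀ x₀ : M, ∃ N ∈ 𝓝 x₀, ∃ K : Set (Cotangent n M), IsCompact K ∧
      ∀ q : Cotangent n M, q.proj ∈ N → conorm q ≤ R → q ∈ K := by
    intro x₀
    let p₀ : Cotangent n M := ⟨x₀, 0⟩
    let e := extChartAt (cotangentModel n) p₀
    let e₀ := extChartAt (𝓡 n) x₀
    obtain ⟨C, hC, hCev⟩ := eventually_norm_symmL_trivializationAt_lt (EuclideanSpace ℝ (Fin n))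
      (fun x : M ↦ TangentSpace (𝓡 n) x) x₀
    obtain ⟨ε, hε, hball⟩ := Metric.nhds_basis_closedBall.mem_iff.1
      (extChartAt_target_mem_nhds (I := 𝓡 n) x₀)
    have het : e.target = e₀.target ×ˢ univ := by
      rw [FiberBundle.extChartAt_target]
      congr 1
      refine inter_eq_left.2 fun y hy ↦ ?_
      have := e₀.map_target hy
      rw [extChartAt_source] at this
      exact ⟨this, mem_univ _⟩
    have hK : Metric.closedBall (e₀ x₀) ε ×ˢ Metric.closedBall 0 (C * R) ⊆ e.target := by
      rw [het]
      exact prod_mono hball (subset_univ _)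
    refine ⟨{x | ‖(trivializationAt (EuclideanSpace ℝ (Fin n)) (TangentSpace (𝓡 n)) x₀).symmL ℝ x‖ < C}
      ∩ (e₀.source ∩ e₀ ⁻¹' Metric.closedBall (e₀ x₀) ε),
      inter_mem hCev (inter_mem (extChartAt_source_mem_nhds x₀)
        ((continuousAt_extChartAt x₀).preimage_mem_nhds (Metric.closedBall_mem_nhds _ hε))),
      e.symm '' (Metric.closedBall (e₀ x₀) ε ×ˢ Metric.closedBall 0 (C * R)),
      ((isCompact_closedBall _ _).prod (isCompact_closedBall _ _)).image_of_continuousOn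
        ((continuousOn_extChartAt_symm p₀).mono hK), ?_⟩
    rintro q ⟨hq1, hq2, hq3⟩ hqR
    have hqs : q ∈ e.source := by
      change q ∈ (extChartAt (cotangentModel n) p₀).source
      rw [extChartAt_source] at hq2
      rw [FiberBundle.extChartAt, PartialEquiv.trans_source]
      refine ⟨(Trivialization.mem_source _).2 ⟨hq2, mem_univ _⟩, ?_⟩
      rw [← extChartAt_source (𝓡 n)] at hq2
      exact ⟨hq2, mem_univ _⟩
    refine ⟨e q, ⟨hq3, ?_⟩, e.left_inv hqs⟩
    have h1 := covector_comp_symmL p₀ (e.map_source hqs)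
    rw [e.left_inv hqs] at h1
    rw [mem_closedBall_zero_iff]
    refine (congrArg norm h1).symm.le.trans ?_
    refine (ContinuousLinearMap.opNorm_comp_le _ _).trans ?_
    rw [mul_comm]
    exact mul_le_mul hq1.le hqR (norm_nonneg _) hC.le
  choose N hN K hK hNK using hloc
  obtain ⟨t, -, ht⟩ := isCompact_univ.elim_nhds_subcover N fun x _ ↦ hN x
  refine (t.isCompact_biUnion fun x _ ↦ hK x).of_isClosed_subset
    (isClosed_le continuous_conorm continuous_const) fun q hq ↦ ?_
  obtain ⟨x, hx, hqx⟩ := mem_iUnion₂.1 (ht (mem_univ q.proj))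
  exact mem_iUnion₂.2 ⟨x, hx, hNK x q hqx hq⟩

end Radial

/-- If `F ∘ u` moves in the kernel of `l`, where `F` is immersive and `D φ = l ∘ DF`, then `φ ∘ u`
is stationary. -/
lemma hasDerivWithinAt_comp_eq_zero {V W : Type*} [NormedAddCommGroup V] [NormedSpace ℝ V]
    [FiniteDimensional ℝ V] [NormedAddCommGroup W] [NormedSpace ℝ W] {F : V → W} {φ : V → ℝ}
    {A : V →L[ℝ] W} {l : W →L[ℝ] ℝ} {u : ℝ → V} {y' : W} {S : Set ℝ} {s : ℝ}
    (hF : HasFDerivAt F A (u s)) (hA : Function.Injective A)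
    (hφ : HasFDerivAt φ (l.comp A) (u s)) (hu : ContinuousWithinAt u S s)
    (hy : HasDerivWithinAt (F ∘ u) y' S s) (hl : l y' = 0) :
    HasDerivWithinAt (φ ∘ u) 0 S s := by
  obtain ⟨C, -, hC⟩ := (A : V →ₗ[ℝ] W).exists_antilipschitzWith (LinearMap.ker_eq_bot.2 hA)
  have hFu : (fun t ↦ F (u t) - F (u s) - A (u t - u s)) =o[𝓝[S] s] fun t ↦ u t - u s :=
    (hasFDerivAt_iff_isLittleO.1 hF).comp_tendsto hu
  have hAu : (fun t ↦ u t - u s) =O[𝓝[S] s] fun t ↦ A (u t - u s) :=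
    Asymptotics.isBigO_of_le' (c := C) _ fun t ↦ by
      simpa [dist_eq_norm] using hC.le_mul_dist (u t - u s) 0
  have hrev : (fun t ↦ u t - u s) =O[𝓝[S] s] fun t ↦ t - s := by
    refine hAu.trans (((hFu.trans_isBigO hAu).right_isBigO_add.congr_right fun t ↦ ?_).trans
      hy.differentiableWithinAt.isBigO_sub)
    simp
  have h1 : (fun t ↦ φ (u t) - φ (u s) - l (A (u t - u s))) =o[𝓝[S] s] fun t ↦ t - s :=
    ((hasFDerivAt_iff_isLittleO.1 hφ).comp_tendsto hu).trans_isBigO hrev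
  have h2 : (fun t ↦ l (F (u t) - F (u s) - A (u t - u s))) =o[𝓝[S] s] fun t ↦ t - s :=
    (l.isBigO_comp _ _).trans_isLittleO (hFu.trans_isBigO hrev)
  have h3 : (fun t ↦ l (F (u t) - F (u s) - (t - s) • y')) =o[𝓝[S] s] fun t ↦ t - s :=
    (l.isBigO_comp _ _).trans_isLittleO (hasDerivWithinAt_iff_isLittleO.1 hy)
  rw [hasDerivWithinAt_iff_isLittleO]
  refine ((h1.sub h2).add h3).congr_left fun t ↦ ?_
  simp only [map_sub, map_smul, hl, Function.comp_apply, smul_zero]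
  ring

section Cone

variable {n : ℕ} {M : Type*} [TopologicalSpace M] [ChartedSpace (EuclideanSpace ℝ (Fin n)) M]
  [IsManifold (𝓡 n) ∞ M]
  {L : Type*} [TopologicalSpace L] [ChartedSpace (EuclideanSpace ℝ (Fin n)) L]

/-- A primitive is stationary along the lifts of the rays of `T*M`. -/
lemma IsPrimitive.hasDerivWithinAt_ray {i : L → Cotangent n M} (hi : IsLagrangianImmersion i)
    {f : L → ℝ} (hf : IsPrimitive i f) {q : Cotangent n M} {c : ℝ → L} {S : Set ℝ} {s : ℝ}
    (hs : s ∈ S) (hc : ContinuousWithinAt c S s) (hray : ∀ t ∈ S, i (c t) = fiberScale t q) :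
    HasDerivWithinAt (f ∘ c) 0 S s := by
  let e := extChartAt (𝓡 n) (c s)
  let e' := extChartAt (cotangentModel n) (i (c s))
  let z : PhaseSpace n := e' q
  let F : EuclideanSpace ℝ (Fin n) → PhaseSpace n := e' ∘ i ∘ e.symm
  have hid : MDifferentiableAt (𝓡 n) (cotangentModel n) i (c s) :=
    hi.contMDiff.mdifferentiable (by simp) _
  have hfd : MDifferentiableAt (𝓡 n) 𝓘(ℝ, ℝ) f (c s) := hf.contMDiff.mdifferentiable (by simp) _
  obtain ⟨A, hA⟩ : ∃ A : EuclideanSpace ℝ (Fin n) →L[ℝ] PhaseSpace n,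
    A = mfderiv (𝓡 n) (cotangentModel n) i (c s) := ⟨_, rfl⟩
  obtain ⟨B, hB⟩ : ∃ B : EuclideanSpace ℝ (Fin n) →L[ℝ] ℝ,
    B = mfderiv (𝓡 n) 𝓘(ℝ, ℝ) f (c s) := ⟨_, rfl⟩
  have hFd : HasFDerivAt F A (e (c s)) := by
    have h : HasFDerivWithinAt F A (range (𝓡 n)) (e (c s)) := by
      rw [hA]
      exact hid.hasMFDerivAt.2
    rwa [ModelWithCorners.range_eq_univ, hasFDerivWithinAt_univ] at h
  have hφd : HasFDerivAt (f ∘ e.symm) B (e (c s)) := by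
    have h : HasFDerivWithinAt (f ∘ e.symm) B (range (𝓡 n)) (e (c s)) := by
      rw [hB]
      exact hfd.hasMFDerivAt.2
    rwa [ModelWithCorners.range_eq_univ, hasFDerivWithinAt_univ] at h
  let l : PhaseSpace n →L[ℝ] ℝ := (e' (i (c s))).2.comp (ContinuousLinearMap.fst ℝ _ _)
  have hBA : B = l.comp A := by
    refine ContinuousLinearMap.ext fun w ↦ ?_
    have h1 : B w = canonicalOneForm (i (c s)) (mfderiv (𝓡 n) (cotangentModel n) i (c s) w) := by
      rw [hB]
      exact hf.mfderiv_eq (c s) w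
    refine h1.trans (canonicalOneForm_eq_chart (mem_extChartAt_source _) _ (A w) ?_)
    rw [mfderiv_extChartAt_eq_tangentCoordChange (mem_extChartAt_source _), hA]
    exact (tangentCoordChange_self (mem_extChartAt_source _)).symm
  have hcs : ∀ᶠ t in 𝓝[S] s, c t ∈ e.source := hc (extChartAt_source_mem_nhds (c s))
  have hle : ∀ t, c t ∈ e.source → e.symm (e (c t)) = c t := fun t ht ↦ e.left_inv ht
  have hy : HasDerivWithinAt (F ∘ fun t ↦ e (c t)) ((0, z.2) : PhaseSpace n) S s := by
    have h1 : HasDerivAt (fun t : ℝ ↦ ((z.1, t • z.2) : PhaseSpace n)) (0, z.2) s := by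
      simpa using (hasDerivAt_const s z.1).prodMk ((hasDerivAt_id s).smul_const z.2)
    have h2 : ∀ t ∈ S, c t ∈ e.source → (F ∘ fun t ↦ e (c t)) t = (z.1, t • z.2) := fun t ht hct ↦ by
      simp only [F, Function.comp_apply]
      rw [hle t hct, hray t ht]
      exact extChartAt_fiberScale _ _ _
    refine h1.hasDerivWithinAt.congr_of_eventuallyEq ?_ (h2 s hs (mem_extChartAt_source _))
    filter_upwards [hcs, self_mem_nhdsWithin] with t ht htS using h2 t htS ht
  have key := hasDerivWithinAt_comp_eq_zero (F := F) (φ := f ∘ e.symm) (A := A) (l := l)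
    (u := fun t ↦ e (c t)) hFd (by rw [hA]; exact hi.injective_mfderiv (c s))
    (by rwa [← hBA]) ((continuousAt_extChartAt (c s)).comp_continuousWithinAt hc) hy
    (by simp [l])
  refine key.congr_of_eventuallyEq ?_ ?_
  · filter_upwards [hcs] with t ht
    simp only [Function.comp_apply]
    rw [hle t ht]
  · simp only [Function.comp_apply]
    rw [hle s (mem_extChartAt_source _)]

variable [RiemannianBundle (fun x : M ↦ TangentSpace (𝓡 n) x)]

/-- The points of norm at least `1` lie on lifted rays that start on the unit cosphere bundle. -/
lemma IsEventuallyConical.exists_ray {i : L → Cotangent n M} (hi : IsEventuallyConical i) {p : L}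
    (hp : 1 ≤ conorm (i p)) : ∃ c : ℝ → L, ContinuousOn c (Ici 1) ∧ c (conorm (i p)) = p ∧
      ∃ q, conorm q = 1 ∧ ∀ t ∈ Ici (1 : ℝ), i (c t) = fiberScale t q := by
  obtain ⟨Λ, hΛ, hcone⟩ := hi.exists_cone
  obtain ⟨U, hU, hCU, hemb⟩ := hi.exists_embedded
  have hinj : ∀ x y, 1 ≤ conorm (i x) → 1 ≤ conorm (i y) → i x = i y → x = y :=
    fun x y hx hy hxy ↦ congrArg Subtype.val
      (hemb.injective (a₁ := ⟨x, hCU hx⟩) (a₂ := ⟨y, hCU hy⟩) hxy)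
  obtain ⟨q, hq, r, hr, hpq⟩ : i p ∈ {q | ∃ q₀ ∈ Λ, ∃ r : ℝ, 1 ≤ r ∧ q = fiberScale r q₀} :=
    hcone ▸ mem_image_of_mem i hp
  have hlift : ∀ t : ℝ, ∃ x, 1 ≤ t → 1 ≤ conorm (i x) ∧ i x = fiberScale t q := fun t ↦ by
    by_cases ht : 1 ≤ t
    · obtain ⟨x, hx, hxt⟩ : fiberScale t q ∈ i '' {p | 1 ≤ conorm (i p)} :=
        hcone ▸ ⟨q, hq, t, ht, rfl⟩
      exact ⟨x, fun _ ↦ ⟨hx, hxt⟩⟩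
    · exact ⟨p, fun h ↦ absurd h ht⟩
  choose c hc using hlift
  refine ⟨c, ?_, ?_, q, hΛ q hq, fun t ht ↦ (hc t ht).2⟩
  · have h1 : Continuous (fun t : Ici (1 : ℝ) ↦ (⟨c t, hCU (hc t t.2).1⟩ : U)) := by
      rw [hemb.isInducing.continuous_iff]
      have h2 : (U.domRestrict i ∘ fun t : Ici (1 : ℝ) ↦ (⟨c t, hCU (hc t t.2).1⟩ : U))
          = fun t : Ici (1 : ℝ) ↦ fiberScale (t : ℝ) q := funext fun t ↦ (hc t t.2).2
      rw [h2]
      exact (contMDiff_fiberScale q).continuous.comp continuous_subtype_val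
    rw [continuousOn_iff_continuous_domRestrict]
    exact continuous_subtype_val.comp h1
  · have hrp : conorm (i p) = r := by
      rw [hpq, conorm_fiberScale, hΛ q hq, mul_one, abs_of_nonneg (by linarith)]
    rw [hrp]
    exact hinj _ _ (hc r hr).1 hp ((hc r hr).2.trans hpq.symm)

/-- Primitives of eventually conical Lagrangians are bounded. -/
lemma IsEventuallyConical.exists_abs_primitive_le {i : L → Cotangent n M}
    (hi : IsEventuallyConical i) {f : L → ℝ} (hf : IsPrimitive i f) : ∃ C, ∀ p, |f p| ≤ C := by
  obtain ⟨C, hC⟩ := hi.isCompact_core.exists_bound_of_continuousOn hf.contMDiff.continuous.continuousOn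
  refine ⟨C, fun p ↦ ?_⟩
  rcases le_total (conorm (i p)) 1 with hp | hp
  · exact hC p hp
  · obtain ⟨c, hc, hcp, q, hq, hray⟩ := hi.exists_ray hp
    have h1 : f p = f (c 1) := by
      have h2 := constant_of_has_deriv_right_zero (f := f ∘ c) (a := 1) (b := conorm (i p))
        (hf.contMDiff.continuous.comp_continuousOn (hc.mono Icc_subset_Ici_self))
        (fun s hs ↦ hf.hasDerivWithinAt_ray hi.isExactLagrangian.isLagrangianImmersion self_mem_Ici
          ((hc s hs.1).mono (Ici_subset_Ici.2 hs.1)) fun t ht ↦ hray t (hs.1.trans ht))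
        (conorm (i p)) (right_mem_Icc.2 hp)
      simpa only [Function.comp_apply, hcp] using h2
    rw [h1]
    refine hC (c 1) ?_
    change conorm (i (c 1)) ≤ 1
    rw [hray 1 self_mem_Ici, fiberScale_one, hq]

lemma IsEventuallyConical.isCompact_setOf_conorm_le
    [IsContMDiffRiemannianBundle (𝓡 n) ∞ (EuclideanSpace ℝ (Fin n))
      (fun x : M ↦ TangentSpace (𝓡 n) x)] {i : L → Cotangent n M}
    (hi : IsEventuallyConical i) (R : ℝ) : IsCompact {p | conorm (i p) ≤ R} := by
  obtain ⟨Λ, hΛ, hcone⟩ := hi.exists_cone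
  obtain ⟨U, hU, hCU, hemb⟩ := hi.exists_embedded
  have hci : Continuous i := hi.isExactLagrangian.isLagrangianImmersion.contMDiff.continuous
  have hcc : Continuous fun p ↦ conorm (i p) := continuous_conorm.comp hci
  have hΛc : IsCompact Λ := by
    have h1 : IsCompact (i '' {p | conorm (i p) = 1}) :=
      (hi.isCompact_core.of_isClosed_subset (isClosed_eq hcc continuous_const)
        fun p hp ↦ le_of_eq hp).image hci
    convert h1
    refine Subset.antisymm (fun q hq ↦ ?_) ?_
    · obtain ⟨x, -, hxq⟩ : q ∈ i '' {p | 1 ≤ conorm (i p)} :=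
        hcone ▸ ⟨q, hq, 1, le_rfl, (fiberScale_one q).symm⟩
      exact ⟨x, (congrArg conorm hxq).trans (hΛ q hq), hxq⟩
    · rintro _ ⟨p, hp, rfl⟩
      obtain ⟨q, hq, r, hr, hpq⟩ : i p ∈ {q | ∃ q₀ ∈ Λ, ∃ r : ℝ, 1 ≤ r ∧ q = fiberScale r q₀} :=
        hcone ▸ mem_image_of_mem i (le_of_eq hp.symm)
      have hr1 : r = 1 := by
        have h2 : conorm (i p) = r := by
          rw [hpq, conorm_fiberScale, hΛ q hq, mul_one, abs_of_nonneg (by linarith)]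
        exact h2.symm.trans hp
      rw [hpq, hr1, fiberScale_one]
      exact hq
  let K : Set (Cotangent n M) := (fun x : ℝ × Cotangent n M ↦ fiberScale x.1 x.2) '' (Icc 1 R ×ˢ Λ)
  have hK : IsCompact K := (isCompact_Icc.prod hΛc).image continuous_fiberScale
  have hKr : K ⊆ range (U.domRestrict i) := by
    rintro _ ⟨⟨r, q⟩, ⟨hr, hq⟩, rfl⟩
    obtain ⟨x, hx, hxr⟩ : fiberScale r q ∈ i '' {p | 1 ≤ conorm (i p)} :=
      hcone ▸ ⟨q, hq, r, hr.1, rfl⟩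
    exact ⟨⟨x, hCU hx⟩, hxr⟩
  have h2 : IsCompact (Subtype.val '' (U.domRestrict i ⁻¹' K)) :=
    ((hemb.isInducing.isCompact_preimage_iff hKr).2 hK).image continuous_subtype_val
  refine (hi.isCompact_core.union h2).of_isClosed_subset (isClosed_le hcc continuous_const) ?_
  intro p hp
  rcases le_total (conorm (i p)) 1 with hp1 | hp1
  · exact Or.inl hp1
  · obtain ⟨q, hq, r, hr, hpq⟩ : i p ∈ {q | ∃ q₀ ∈ Λ, ∃ r : ℝ, 1 ≤ r ∧ q = fiberScale r q₀} :=
      hcone ▸ mem_image_of_mem i hp1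
    have hrp : conorm (i p) = r := by
      rw [hpq, conorm_fiberScale, hΛ q hq, mul_one, abs_of_nonneg (by linarith)]
    refine Or.inr ⟨⟨p, hCU hp1⟩, ⟨(r, q), ⟨⟨hr, hrp ▸ hp⟩, hq⟩, hpq.symm⟩, rfl⟩

end Cone

section Flow

variable {n : ℕ} {M : Type*} [TopologicalSpace M] [ChartedSpace (EuclideanSpace ℝ (Fin n)) M]
  [IsManifold (𝓡 n) ∞ M] [RiemannianBundle (fun x : M ↦ TangentSpace (𝓡 n) x)]
  [IsContMDiffRiemannianBundle (𝓡 n) ∞ (EuclideanSpace ℝ (Fin n))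
      (fun x : M ↦ TangentSpace (𝓡 n) x)] {β : ℝ → ℝ}

/-- The radial profile of the function `k` by which the flow of the Reeb perturbation shifts the
canonical one-form. -/
noncomputable def shiftProfile (β : ℝ → ℝ) (r : ℝ) : ℝ := β r * r - antiderivFromOne β r

lemma contMDiff_shiftProfile_conorm (hβ : ContDiff ℝ ∞ β) (hβ0 : ∀ r < 1, β r = 0) :
    ContMDiff (cotangentModel n) 𝓘(ℝ, ℝ) ∞ (fun p : Cotangent n M ↦ shiftProfile β (conorm p)) :=
  contMDiff_comp_conorm ((hβ.mul contDiff_id).sub (contDiff_antiderivFromOne hβ)) fun r hr ↦ by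
    rw [shiftProfile, hβ0 r hr, antiderivFromOne_eq_zero hβ.continuous hβ0 hr.le, zero_mul, sub_zero]

lemma tendsto_shiftProfile (hβ : Continuous β) {r₀ : ℝ} (hr₀ : 0 < r₀)
    (hβ_end : ∀ r, r₀ ≤ r → β r = 1 / r) : Tendsto (shiftProfile β) atTop atBot := by
  have h := tendsto_atBot_add_const_left atTop (1 : ℝ)
    (tendsto_neg_atTop_atBot.comp (tendsto_antiderivFromOne hβ hr₀ hβ_end))
  refine h.congr' ?_
  filter_upwards [eventually_ge_atTop r₀] with r hr
  rw [shiftProfile, hβ_end r hr, one_div_mul_cancel (by linarith), Function.comp_apply, sub_eq_add_neg]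

variable [T2Space M]

/-- The Reeb perturbation of a compact manifold is complete. -/
theorem exists_isFlowOf_reebPerturbation [CompactSpace M] (hβ : ContDiff ℝ ∞ β)
    (hβ0 : ∀ r < 1, β r = 0) :
    ∃ φ : ℝ → Cotangent n M → Cotangent n M, IsFlowOf (reebPerturbation β) φ := by
  have h : ∀ p : Cotangent n M, ∃ γ : ℝ → Cotangent n M, γ 0 = p ∧
      IsMIntegralCurve (I := cotangentModel n) γ (reebPerturbation β) := by
    intro p
    have hp := conorm_nonneg p
    let χ : ContDiffBump (0 : ℝ) := ⟨conorm p + 1, conorm p + 2, by linarith, by linarith⟩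
    have hβχ : ContDiff ℝ ∞ (fun r ↦ β r * χ r) := hβ.mul χ.contDiff
    have hβχ0 : ∀ r < 1, β r * χ r = 0 := fun r hr ↦ by rw [hβ0 r hr, zero_mul]
    have hX : IsSmoothField (cotangentModel n) (reebPerturbation (M := M) fun r ↦ β r * χ r) := by
      rw [reebPerturbation_eq hβχ hβχ0]
      exact isSmoothField_hamiltonianVectorField (contMDiff_antiderivFromOne_conorm hβχ hβχ0)
    obtain ⟨γ, hγ0, hγ⟩ := hX.exists_isMIntegralCurve (isCompact_setOf_conorm_le (conorm p + 2))
      (fun q hq ↦ by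
        have hχ : χ (conorm q) = 0 := χ.zero_of_le_dist (by
          rw [Real.dist_0_eq_abs, abs_of_nonneg (conorm_nonneg q)]
          exact (not_le.1 hq).le)
        simp only [reebPerturbation, hχ, mul_zero, zero_smul]) p
    refine ⟨γ, hγ0, fun t ↦ ?_⟩
    have h1 : conorm (γ t) = conorm p := by
      rw [conorm_eq_of_isMIntegralCurve hβχ hβχ0 hγ t 0, hγ0]
    have h2 : χ (conorm (γ t)) = 1 := χ.one_of_mem_closedBall (by
      rw [mem_closedBall_zero_iff, Real.norm_eq_abs, h1, abs_of_nonneg hp]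
      exact (lt_add_one _).le)
    have h3 : reebPerturbation (fun r ↦ β r * χ r) (γ t) = reebPerturbation β (γ t) := by
      simp only [reebPerturbation, h2, mul_one]
    rw [← h3]
    exact hγ t
  choose γ hγ0 hγ using h
  exact ⟨fun t p ↦ γ p t, fun p ↦ ⟨hγ0 p, hγ p⟩⟩

/-- The flow of the Reeb perturbation shifts the canonical one-form by an exact form. -/
lemma IsFlowOf.shiftsOneFormAt (hβ : ContDiff ℝ ∞ β) (hβ0 : ∀ r < 1, β r = 0)
    {φ : ℝ → Cotangent n M → Cotangent n M} (hφ : IsFlowOf (reebPerturbation β) φ) (t : ℝ)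
    (p : Cotangent n M) :
    ShiftsOneFormAt ∞ (fun p : Cotangent n M ↦ shiftProfile β (conorm p)) φ t p := by
  refine hamiltonianFlow_shiftsOneForm (contMDiff_antiderivFromOne_conorm hβ hβ0)
    (contMDiff_shiftProfile_conorm hβ hβ0) (fun p ↦ ?_) (by rwa [← reebPerturbation_eq hβ hβ0])
    (fun t p ↦ ?_) t p
  · rw [← reebPerturbation_eq hβ hβ0, canonicalOneForm_reebPerturbation hβ hβ0, shiftProfile]
  · rw [conorm_eq_of_isMIntegralCurve hβ hβ0 (hφ p).2 t 0, (hφ p).1]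

/-- The flow maps of the Reeb perturbation are immersions. -/
lemma IsFlowOf.injective_mfderiv (hβ : ContDiff ℝ ∞ β) (hβ0 : ∀ r < 1, β r = 0)
    {φ : ℝ → Cotangent n M → Cotangent n M} (hφ : IsFlowOf (reebPerturbation β) φ) (t : ℝ)
    (p : Cotangent n M) :
    Function.Injective (mfderiv (cotangentModel n) (cotangentModel n) (φ t) p) := by
  have hX : IsSmoothField (cotangentModel n) (reebPerturbation (M := M) β) := by
    rw [reebPerturbation_eq hβ hβ0]
    exact isSmoothField_hamiltonianVectorField (contMDiff_antiderivFromOne_conorm hβ hβ0)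
  have hinv : φ (-t) ∘ φ t = id := funext fun q ↦ by
    have h := hX.flow_add (fun p ↦ (hφ p).1) (fun p ↦ (hφ p).2) t (-t) q
    rw [add_neg_cancel, (hφ q).1] at h
    exact h.symm
  have hd : ∀ t q, MDifferentiableAt (cotangentModel n) (cotangentModel n) (φ t) q :=
    fun t q ↦ (hφ.shiftsOneFormAt hβ hβ0 t q).1.mdifferentiableAt (by simp)
  have h := mfderiv_comp p (hd (-t) (φ t p)) (hd t p)
  rw [hinv, mfderiv_id] at h
  exact Function.LeftInverse.injective fun v ↦ (DFunLike.congr_fun h v).symm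

variable {L : Type*} [TopologicalSpace L] [ChartedSpace (EuclideanSpace ℝ (Fin n)) L]

/-- The differential of a function on `L`, as a real-valued one-form. -/
noncomputable def realDifferential (f : L → ℝ) (p : L) : TangentSpace (𝓡 n) p →L[ℝ] ℝ :=
  mfderiv (𝓡 n) 𝓘(ℝ, ℝ) f p

lemma realDifferential_add_const_mul {a b : L → ℝ} {p : L} (c : ℝ)
    (ha : MDifferentiableAt (𝓡 n) 𝓘(ℝ, ℝ) a p) (hb : MDifferentiableAt (𝓡 n) 𝓘(ℝ, ℝ) b p)
    (v : TangentSpace (𝓡 n) p) :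
    realDifferential (fun p ↦ a p + c * b p) p v
      = realDifferential a p v + c * realDifferential b p v :=
  DFunLike.congr_fun (ha.hasMFDerivAt.add (hb.hasMFDerivAt.const_smul c)).mfderiv v

/-- The flow of the Reeb perturbation turns the pull-back `i^* α` into `i^* α + t d(k ∘ i)`. -/
lemma IsFlowOf.canonicalOneForm_mfderiv_comp (hβ : ContDiff ℝ ∞ β) (hβ0 : ∀ r < 1, β r = 0)
    {φ : ℝ → Cotangent n M → Cotangent n M} (hφ : IsFlowOf (reebPerturbation β) φ) (t : ℝ)
    {i : L → Cotangent n M} {p : L} (hi : MDifferentiableAt (𝓡 n) (cotangentModel n) i p)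
    (v : TangentSpace (𝓡 n) p) :
    canonicalOneForm ((φ t ∘ i) p) (mfderiv (𝓡 n) (cotangentModel n) (φ t ∘ i) p v)
      = canonicalOneForm (i p) (mfderiv (𝓡 n) (cotangentModel n) i p v)
        + t * realDifferential (fun p ↦ shiftProfile β (conorm (i p))) p v := by
  obtain ⟨h1, h2⟩ := hφ.shiftsOneFormAt hβ hβ0 t (i p)
  have h3 : mfderiv (𝓡 n) (cotangentModel n) (φ t ∘ i) p v
      = mfderiv (cotangentModel n) (cotangentModel n) (φ t) (i p)
        (mfderiv (𝓡 n) (cotangentModel n) i p v) :=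
    DFunLike.congr_fun (mfderiv_comp p (h1.mdifferentiableAt (by simp)) hi) v
  have h4 : realDifferential (fun p ↦ shiftProfile β (conorm (i p))) p v
      = differential (fun p : Cotangent n M ↦ shiftProfile β (conorm p)) (i p)
        (mfderiv (𝓡 n) (cotangentModel n) i p v) :=
    DFunLike.congr_fun (mfderiv_comp p
      ((contMDiff_shiftProfile_conorm hβ hβ0).mdifferentiable (by simp) (i p)) hi) v
  rw [h4]
  exact (congrArg (canonicalOneForm (φ t (i p))) h3).trans (h2 _)

lemma isPrimitive_flow_comp_iff (hβ : ContDiff ℝ ∞ β) (hβ0 : ∀ r < 1, β r = 0)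
    {φ : ℝ → Cotangent n M → Cotangent n M} (hφ : IsFlowOf (reebPerturbation β) φ) (t : ℝ)
    {i : L → Cotangent n M} (hi : ContMDiff (𝓡 n) (cotangentModel n) ∞ i) {f : L → ℝ} :
    IsPrimitive (φ t ∘ i) (fun p ↦ f p + t * shiftProfile β (conorm (i p))) ↔ IsPrimitive i f := by
  have hk : ContMDiff (𝓡 n) 𝓘(ℝ, ℝ) ∞ (fun p ↦ shiftProfile β (conorm (i p))) :=
    (contMDiff_shiftProfile_conorm hβ hβ0).comp hi
  have htk : ContMDiff (𝓡 n) 𝓘(ℝ, ℝ) ∞ (fun p ↦ t * shiftProfile β (conorm (i p))) :=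
    contMDiff_const.mul hk
  have key : ∀ p v, MDifferentiableAt (𝓡 n) 𝓘(ℝ, ℝ) f p →
      ((realDifferential (fun p ↦ f p + t * shiftProfile β (conorm (i p))) p v
        = canonicalOneForm ((φ t ∘ i) p) (mfderiv (𝓡 n) (cotangentModel n) (φ t ∘ i) p v)) ↔
      realDifferential f p v
        = canonicalOneForm (i p) (mfderiv (𝓡 n) (cotangentModel n) i p v)) := fun p v hf ↦ by
    rw [hφ.canonicalOneForm_mfderiv_comp hβ hβ0 t (hi.mdifferentiable (by simp) p) v,
      realDifferential_add_const_mul t hf (hk.mdifferentiable (by simp) p)]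
    exact add_left_inj _
  constructor
  · rintro ⟨h1, h2⟩
    have hf : ContMDiff (𝓡 n) 𝓘(ℝ, ℝ) ∞ f := by
      have := h1.sub htk
      simpa using this
    exact ⟨hf, fun p v ↦ (key p v (hf.mdifferentiable (by simp) p)).1 (h2 p v)⟩
  · rintro ⟨h1, h2⟩
    exact ⟨h1.add htk, fun p v ↦ (key p v (h1.mdifferentiable (by simp) p)).2 (h2 p v)⟩

end Flow

lemma IsEventuallyConical.tendsto_conorm {n : ℕ} {M : Type*} [TopologicalSpace M]
    [ChartedSpace (EuclideanSpace ℝ (Fin n)) M] [IsManifold (𝓡 n) ∞ M]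
    [RiemannianBundle (fun x : M ↦ TangentSpace (𝓡 n) x)]
    [IsContMDiffRiemannianBundle (𝓡 n) ∞ (EuclideanSpace ℝ (Fin n))
      (fun x : M ↦ TangentSpace (𝓡 n) x)]
    {L : Type*} [TopologicalSpace L] [ChartedSpace (EuclideanSpace ℝ (Fin n)) L]
    {i : L → Cotangent n M} (hi : IsEventuallyConical i) :
    Tendsto (fun p ↦ conorm (i p)) (cocompact L) atTop := by
  refine tendsto_atTop.2 fun R ↦ ?_
  filter_upwards [(hi.isCompact_setOf_conorm_le R).compl_mem_cocompact] with p hp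
  have hp' : ¬ conorm (i p) ≤ R := hp
  exact (not_le.1 hp').le

lemma bddAbove_range_of_tendsto_cocompact_atBot {X : Type*} [TopologicalSpace X] {f : X → ℝ}
    (hf : Continuous f) (h : Tendsto f (cocompact X) atBot) : BddAbove (range f) := by
  obtain ⟨K, hK, hKf⟩ := mem_cocompact.1 (h (Iic_mem_atBot 0))
  obtain ⟨C, hC⟩ := hK.bddAbove_image hf.continuousOn
  refine ⟨max C 0, ?_⟩
  rintro _ ⟨x, rfl⟩
  by_cases hx : x ∈ K
  · exact (hC (mem_image_of_mem f hx)).trans (le_max_left _ _)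
  · exact le_trans (hKf hx) (le_max_right _ _)

theorem mainTheorem12 {n : ℕ}
    {M : Type*} [TopologicalSpace M] [ChartedSpace (EuclideanSpace ℝ (Fin n)) M]
    [IsManifold (𝓡 n) ∞ M] [T2Space M] [SecondCountableTopology M]
    [RiemannianBundle (fun x : M ↦ TangentSpace (𝓡 n) x)]
    [IsContMDiffRiemannianBundle (𝓡 n) ∞ (EuclideanSpace ℝ (Fin n))
      (fun x : M ↦ TangentSpace (𝓡 n) x)]
    {L : Type*} [TopologicalSpace L] [ChartedSpace (EuclideanSpace ℝ (Fin n)) L]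
    [IsManifold (𝓡 n) ∞ L] [T2Space L] [SecondCountableTopology L]
    (i : L → Cotangent n M) (hi : IsEventuallyConical i)
    (β : ℝ → ℝ) (hβ : ContDiff ℝ ∞ β) (hβ_supp : ∀ r < 1, β r = 0)
    (r₀ : ℝ) (hr₀ : 1 < r₀) (hβ_end : ∀ r, r₀ ≤ r → β r = 1 / r) :
    (CompactSpace M →
      ∃ φ : ℝ → Cotangent n M → Cotangent n M, IsFlowOf (reebPerturbation β) φ) ∧
    ∀ φ : ℝ → Cotangent n M → Cotangent n M, IsFlowOf (reebPerturbation β) φ →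
      ∀ ε₀ : ℝ, 0 < ε₀ →
        IsLowerExact (φ ε₀ ∘ i) ∧
        ∀ f, IsPrimitive (φ ε₀ ∘ i) f → Tendsto f (cocompact L) atBot := by
  refine ⟨fun _ ↦ exists_isFlowOf_reebPerturbation hβ hβ_supp, fun φ hφ ε₀ hε₀ ↦ ?_⟩
  have hL := hi.isExactLagrangian.isLagrangianImmersion
  have hφd : ∀ q, ContMDiffAt (cotangentModel n) (cotangentModel n) ∞ (φ ε₀) q :=
    fun q ↦ (hφ.shiftsOneFormAt hβ hβ_supp ε₀ q).1
  have hsmooth : ContMDiff (𝓡 n) (cotangentModel n) ∞ (φ ε₀ ∘ i) :=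
    fun p ↦ (hφd (i p)).comp p (hL.contMDiff p)
  obtain ⟨f, hf⟩ := hi.isExactLagrangian.exists_primitive
  have hprim := (isPrimitive_flow_comp_iff hβ hβ_supp hφ ε₀ hL.contMDiff).2 hf
  have htendsto : ∀ g, IsPrimitive (φ ε₀ ∘ i) g → Tendsto g (cocompact L) atBot := by
    intro g hg
    have hg' : IsPrimitive i fun p ↦ g p - ε₀ * shiftProfile β (conorm (i p)) := by
      rw [← isPrimitive_flow_comp_iff hβ hβ_supp hφ ε₀ hL.contMDiff]
      simpa using hg
    obtain ⟨C, hC⟩ := hi.exists_abs_primitive_le hg'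
    have h := tendsto_atBot_add_const_left (cocompact L) C
      (((tendsto_shiftProfile hβ.continuous (one_pos.trans hr₀) hβ_end).comp
        hi.tendsto_conorm).const_mul_atBot hε₀)
    refine tendsto_atBot_mono (fun p ↦ ?_) h
    have := (abs_le.1 (hC p)).2
    simp only [Function.comp_apply]
    linarith
  refine ⟨⟨⟨⟨hsmooth, fun p ↦ ?_, isPrimitive_pullback_canonicalTwoForm hsmooth hprim⟩,
    _, hprim⟩, fun g hg ↦ ?_, fun g hg ↦ ?_⟩, htendsto⟩
  · rw [mfderiv_comp p ((hφd (i p)).mdifferentiableAt (by simp))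
      (hL.contMDiff.mdifferentiable (by simp) p)]
    exact (hφ.injective_mfderiv hβ hβ_supp ε₀ (i p)).comp (hL.injective_mfderiv p)
  · rw [isProperMap_iff_tendsto_cocompact]
    exact ⟨hg.contMDiff.continuous, (htendsto g hg).mono_right atBot_le_cocompact⟩
  · exact bddAbove_range_of_tendsto_cocompact_atBot hg.contMDiff.continuous (htendsto g hg)
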